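/- For a finite simple graph $G$ with at least one vertex, an edge activity $B\ge 0$ and an external field $\lambda\ge 0$, let \[ Z_G(B,\lambda)=\sum_{\sigma:V(G)\to\{+,-\}}B^{m_G(\sigma)}\lambda^{n_G(+,\sigma)} \] be the Ising partition function, where $m_G(\sigma)$ is the number of edges of $G$ whose two endpoints receive the same spin under $\sigma$ and $n_G(+,\sigma)$ is the number of vertices with spin $+$ (and $0^0=1$). The occupancy fraction of $G$ is \[ \alpha_G(B,\lambda)=\frac{\lambda}{|V(G)|}\,\frac{\partial}{\partial\lambda}\log Z_G(B,\lambda), \] with the convention $\alpha_G(B,0)=0$ (a convention is needed only at $(B,\lambda)=(0,0)$, where $Z_G$ may vanish). Theorem 1.4. The complete bipartite graph $K_{3,3}$, which is $3$-regular, maximizes the occupancy fraction over $3$-regular graphs in the union of the following regions; that is, $\alpha_G(B,\lambda)\le\alpha_{K_{3,3}}(B,\lambda)$ for every non-empty finite simple $3$-regular graph $G$ and every $(B,\lambda)$ in $\mathcal R^{\max}_1\cup\mathcal R^{\max}_2\cup\mathcal R^{\max}_3$, where \begin{enumerate} \item $\mathcal R^{\max}_1=\{(B,\lambda): 0\le B\le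 1/5,\ 0\le\lambda\le 3B/10\}$, \item $\mathcal R^{\max}_2=\{(B,\lambda): 1/5\le B\le 2/5,\ 0\le\lambda\le 4B/10\}$, \item $\mathcal R^{\max}_3=\{(B,\lambda): 2/5\le B\le 1,\ 0\le\lambda\le 5B/10\}$. \end{enumerate} -/

import Mathlib

noncomputable section

namespace Ising

/-- The number of monochromatic edges of `G` under the spin assignment `σ`
(the spin `+` is `true`, the spin `-` is `false`). -/
def monoEdges {V : Type*} (G : SimpleGraph V) (σ : V → Bool) : ℕ :=
  {e : Sym2 V | e ∈ G.edgeSet ∧ (e.map σ).IsDiag}.ncard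

/-- The number of vertices with spin `+` under `σ`. -/
def plusCount {V : Type*} (σ : V → Bool) : ℕ :=
  {v : V | σ v = true}.ncard

open Classical in
/-- The Ising partition function with edge activity `B` and external field `lam`. -/
def partitionFunction {V : Type*} [Fintype V] (G : SimpleGraph V) (B lam : ℝ) : ℝ :=
  ∑ σ : V → Bool, B ^ monoEdges G σ * lam ^ plusCount σ

/-- The occupancy fraction `(lam / |V|) * ∂/∂lam log Z_G(B, lam)`. -/
def occupancyFraction {V : Type*} [Fintype V] (G : SimpleGraph V) (B lam : ℝ) : ℝ :=
  lam / (Fintype.card V : ℝ) * deriv (fun l : ℝ => Real.log (partitionFunction G B l)) lam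

/-- The complete bipartite graph with three vertices on each side. -/
abbrev K33 : SimpleGraph (Fin 3 ⊕ Fin 3) := completeBipartiteGraph (Fin 3) (Fin 3)

open Classical in
/-- `G` is a 3-regular graph. -/
def IsCubic {V : Type*} [Fintype V] (G : SimpleGraph V) : Prop :=
  G.IsRegularOfDegree 3

/-- Regions of pairs (edge activity, external field). -/
def regionMax1 : Set (ℝ × ℝ) :=
  {p | 0 ≤ p.1 ∧ p.1 ≤ 1 / 5 ∧ 0 ≤ p.2 ∧ p.2 ≤ 3 * p.1 / 10}

def regionMax2 : Set (ℝ × ℝ) :=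
  {p | 1 / 5 ≤ p.1 ∧ p.1 ≤ 2 / 5 ∧ 0 ≤ p.2 ∧ p.2 ≤ 4 * p.1 / 10}

def regionMax3 : Set (ℝ × ℝ) :=
  {p | 2 / 5 ≤ p.1 ∧ p.1 ≤ 1 ∧ 0 ≤ p.2 ∧ p.2 ≤ 5 * p.1 / 10}

end Ising

end

/-! ### Lattice-gas variables and the dual certificate. -/

namespace Ising

/-! This is the occupancy method: linear-programming duality over local views. On a cubic graph the
Ising weight is, up to the constant B^|E|, that of a lattice gas with weight x = λ/B³ per + vertex
and q = B² per ++ edge (`weight_eq_gasWeight`), and the occupancy fraction is the mean density of +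
vertices. For any function c, the value of c at the number of + neighbours of v, minus its mean over
the three neighbours of v, sums to zero over v (`sum_vertexSlack`). Hence α bounds the density as
soon as some c makes the weighted sum of `vertexSlack` nonpositive at every vertex.

Fixing the spins outside v and its neighbours makes this a finite problem
(`sum_gasWeight_mul_vertexSlack`): what remains depends only on the edges among the neighbours and
on the number of outer + neighbours of each. With α the density of `K33` and c the multiplier
`dual`, all 23 views up to symmetry have sum at most 0 (`GasRange.viewSum_nonpos_of_degree_le`).
Each is a polynomial inequality in x and q that follows from q ≤ 1 and xq ≤ 1/2. The three views
that occur in `K33` are tight, as complementary slackness demands. -/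

/-- The parameter range in lattice-gas variables `q = B ^ 2`, `x = λ / B ^ 3`. -/
structure GasRange (q x : ℝ) : Prop where
  q_nonneg : 0 ≤ q
  q_le_one : q ≤ 1
  x_nonneg : 0 ≤ x
  mul_le_half : x * q ≤ 1 / 2

/-- The partition function of `K33` in lattice-gas variables. -/
def gasZ (q x : ℝ) : ℝ :=
  1 + 6 * x + 3 * x ^ 2 * (2 + 3 * q) + 2 * x ^ 3 * (1 + 9 * q ^ 2) + 3 * x ^ 4 * (2 * q ^ 3 + 3 * q ^ 4)
    + 6 * x ^ 5 * q ^ 6 + x ^ 6 * q ^ 9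

/-- A sixth of `x` times the derivative of `gasZ` in `x`. -/
def gasN (q x : ℝ) : ℝ :=
  x + x ^ 2 * (2 + 3 * q) + x ^ 3 * (1 + 9 * q ^ 2) + 2 * x ^ 4 * (2 * q ^ 3 + 3 * q ^ 4) + 5 * x ^ 5 * q ^ 6
    + x ^ 6 * q ^ 9

/-- The occupancy fraction of `K33` in lattice-gas variables. -/
noncomputable def gasOcc (q x : ℝ) : ℝ := gasN q x / gasZ q x

/-- The factor of the common denominator of the dual multipliers that survives in the slacks. -/
def dualFactor (q x : ℝ) : ℝ := 1 + x * (2 * q ^ 2 - q ^ 3)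

/-- The common denominator of the dual multipliers. -/
def dualDen (q x : ℝ) : ℝ := 2 * gasZ q x * dualFactor q x

/-- Numerator of the dual multiplier `dual q x 1`. -/
def dualNum₁ (q x : ℝ) : ℝ :=
  3 + 3 * x * (4 * q + 7 * q ^ 2 - 5 * q ^ 3) - x ^ 2 * (11 * q - 54 * q ^ 2 - 18 * q ^ 3 + 10 * q ^ 4 + 6
    * q ^ 5) + x ^ 3 * (10 * q ^ 2 + 3 * q ^ 3 + 35 * q ^ 4 + 17 * q ^ 5 + 3 * q ^ 6 - 8 * q ^ 7) + x ^ 4 * (6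
    * q ^ 4 + 5 * q ^ 5 + 42 * q ^ 6 - 14 * q ^ 7 + 4 * q ^ 8 + 3 * q ^ 9 - q ^ 10) + x ^ 5 * (12 * q ^ 7 - 2
    * q ^ 8 + 12 * q ^ 9 - 3 * q ^ 10 - q ^ 11) + 3 * x ^ 6 * (2 * q ^ 10 - q ^ 11)

/-- Numerator of the dual multiplier `dual q x 2`. -/
def dualNum₂ (q x : ℝ) : ℝ :=
  3 + 3 * x * (4 + q + 2 * q ^ 3) + x ^ 2 * (8 + 21 * q + 21 * q ^ 2 + 16 * q ^ 3 - 3 * q ^ 4) + x ^ 3 *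
    (2 - 2 * q + 27 * q ^ 2 + 80 * q ^ 3 + 32 * q ^ 4 - 33 * q ^ 5 - 4 * q ^ 6 + 3 * q ^ 7) + x ^ 4 * (6 *
    q ^ 2 + 17 * q ^ 3 + 44 * q ^ 4 + 42 * q ^ 5 + 6 * q ^ 6 + q ^ 7 - 9 * q ^ 8 - 2 * q ^ 9) + x ^ 5 * (18 *
    q ^ 5 + 31 * q ^ 6 + 19 * q ^ 7 - 3 * q ^ 8 - 4 * q ^ 9 + 2 * q ^ 10) + x ^ 6 * (18 * q ^ 8 + q ^ 9 + 3 *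
    q ^ 10 - q ^ 12) + 3 * x ^ 7 * (2 * q ^ 11 - q ^ 12)

/-- Numerator of the dual multiplier `dual q x 3`. -/
def dualNum₃ (q x : ℝ) : ℝ :=
  -3 - 3 * x * (2 - q + 2 * q ^ 2) + x ^ 2 * (4 + 9 * q - 12 * q ^ 2 + 8 * q ^ 3 + 3 * q ^ 4) + x ^ 3 * (6
    + 30 * q + 11 * q ^ 2 + 14 * q ^ 3 + 31 * q ^ 4 + 4 * q ^ 5 - 2 * q ^ 6 - q ^ 7) + x ^ 4 * (2 + 4 * q
    + 24 * q ^ 2 + 48 * q ^ 3 + 108 * q ^ 4 + 28 * q ^ 5 - 38 * q ^ 6 - q ^ 7 + 5 * q ^ 8) + x ^ 5 * (4 *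
    q ^ 2 + 12 * q ^ 3 + 66 * q ^ 4 + 63 * q ^ 5 + 36 * q ^ 6 + 8 * q ^ 7 + 2 * q ^ 8 - 12 * q ^ 9 - 2 *
    q ^ 10) + x ^ 6 * (12 * q ^ 5 + 54 * q ^ 6 + 11 * q ^ 7 + 36 * q ^ 8 - 15 * q ^ 9 - 5 * q ^ 10 + 3 *
    q ^ 11) + x ^ 7 * (12 * q ^ 8 + 18 * q ^ 9 - 8 * q ^ 10 + 6 * q ^ 11 - q ^ 13) + 3 * x ^ 8 * (2 * q ^ 12 -
    q ^ 13)

/-- Lagrange multipliers of the constraints that the number of `+` spins around a uniform random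
vertex and around a uniform random neighbour of it have the same distribution. They make the three
local views of `K33` and the view with one edge and no `+` spin outside tight. -/
noncomputable def dual (q x : ℝ) : ℕ → ℝ :=
  let c₁ : ℝ := x ^ 2 * (1 - q) ^ 2 * dualNum₁ q x / ((1 + x) * (1 + x * q) * dualDen q x)
  let c₂ : ℝ := x * (1 - q) ^ 2 * dualNum₂ q x / ((1 + x) * (1 + x * q ^ 2) * dualDen q x)
  let c₃ : ℝ := (1 - q) ^ 2 * dualNum₃ q x / ((1 + x) * (1 + x * q ^ 3) * dualDen q x)
  Pi.single 1 c₁ + Pi.single 2 c₂ + Pi.single 3 c₃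

/-- The weighted sum, over the spins of a vertex and its three neighbours, of the dual slack of a
local view: the neighbours `i`, `j` are joined by `hij` edges, and the neighbour `i` has `ai`
outer neighbours with spin `+`. -/
noncomputable def viewSum (q x α : ℝ) (c : ℕ → ℝ) (h₁₂ h₁₃ h₂₃ a₁ a₂ a₃ : ℕ) : ℝ :=
  ∑ t : Bool, ∑ b₁ : Bool, ∑ b₂ : Bool, ∑ b₃ : Bool,
    x ^ (t.toNat + b₁.toNat + b₂.toNat + b₃.toNat) *
      q ^ (t.toNat * (b₁.toNat + b₂.toNat + b₃.toNat) + h₁₂ * (b₁.toNat * b₂.toNat) +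
        h₁₃ * (b₁.toNat * b₃.toNat) + h₂₃ * (b₂.toNat * b₃.toNat) +
        a₁ * b₁.toNat + a₂ * b₂.toNat + a₃ * b₃.toNat) *
      (t.toNat - α + c (b₁.toNat + b₂.toNat + b₃.toNat) -
        (c (a₁ + t.toNat + h₁₂ * b₂.toNat + h₁₃ * b₃.toNat) +
          c (a₂ + t.toNat + h₁₂ * b₁.toNat + h₂₃ * b₃.toNat) +
          c (a₃ + t.toNat + h₁₃ * b₁.toNat + h₂₃ * b₂.toNat)) / 3)

/-! ### Monomial bounds and clearing of denominators. -/

/-- The only source of positivity below. Since x alone is unbounded, powers of x are lowered only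
together with powers of q, each factor xq costing 1/2. Treating monomials as atoms, each polynomial
inequality becomes a linear one. -/
theorem GasRange.mono_le {q x : ℝ} (h : GasRange q x) (c d n m : ℕ) :
    x ^ (d + n) * q ^ (c + n + m) ≤ (1 / 2) ^ n * (x ^ d * q ^ c) := by
  obtain ⟨hq, hq1, hx, hxq⟩ := h
  have h₁ : (x * q) ^ n ≤ (1 / 2) ^ n := pow_le_pow_left₀ (by positivity) hxq n
  have h₂ : q ^ m ≤ 1 := pow_le_one₀ hq hq1
  calc x ^ (d + n) * q ^ (c + n + m) = (x * q) ^ n * q ^ m * (x ^ d * q ^ c) := by ring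
    _ ≤ (1 / 2) ^ n * 1 * (x ^ d * q ^ c) := by gcongr
    _ = _ := by ring

theorem GasRange.mono_nonneg {q x : ℝ} (h : GasRange q x) (c d : ℕ) : 0 ≤ x ^ d * q ^ c :=
  mul_nonneg (pow_nonneg h.x_nonneg d) (pow_nonneg h.q_nonneg c)

theorem GasRange.one_sub_nonneg {q x : ℝ} (h : GasRange q x) : 0 ≤ 1 - q :=
  sub_nonneg.2 h.q_le_one

theorem GasRange.one_sub_sq_mul_cube_nonneg {q x : ℝ} (h : GasRange q x) :
    0 ≤ 1 - x ^ 2 * q ^ 3 := by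
  linarith [h.mono_le 0 0 2 1]

theorem gasZ_pos {q x : ℝ} (hq : 0 ≤ q) (hx : 0 ≤ x) : 0 < gasZ q x := by
  unfold gasZ; positivity

theorem GasRange.dualFactor_pos {q x : ℝ} (h : GasRange q x) : 0 < dualFactor q x := by
  have h₁ : 0 ≤ 2 * q ^ 2 - q ^ 3 := by
    nlinarith [mul_nonneg (sq_nonneg q) h.one_sub_nonneg]
  have h₂ := mul_nonneg h.x_nonneg h₁
  unfold dualFactor; positivity

/-- A view sum is affine in the occupancy fraction and in the multipliers. -/
theorem viewSum_single_add (q x α c₁ c₂ c₃ : ℝ) (h₁₂ h₁₃ h₂₃ a₁ a₂ a₃ : ℕ) :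
    viewSum q x α (Pi.single 1 c₁ + Pi.single 2 c₂ + Pi.single 3 c₃) h₁₂ h₁₃ h₂₃ a₁ a₂ a₃ =
      (1 - α - c₁ - c₂ - c₃) * viewSum q x 0 0 h₁₂ h₁₃ h₂₃ a₁ a₂ a₃ +
        α * viewSum q x 1 0 h₁₂ h₁₃ h₂₃ a₁ a₂ a₃ +
        c₁ * viewSum q x 0 (Pi.single 1 1) h₁₂ h₁₃ h₂₃ a₁ a₂ a₃ +
        c₂ * viewSum q x 0 (Pi.single 2 1) h₁₂ h₁₃ h₂₃ a₁ a₂ a₃ +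
        c₃ * viewSum q x 0 (Pi.single 3 1) h₁₂ h₁₃ h₂₃ a₁ a₂ a₃ := by
  have key (k n : ℕ) (c : ℝ) :
      (Pi.single k c : ℕ → ℝ) n = c * (Pi.single k 1 : ℕ → ℝ) n := by
    simp [Pi.single_apply]
  simp only [viewSum, Pi.add_apply, Pi.zero_apply, key _ _ c₁, key _ _ c₂, key _ _ c₃,
    Finset.mul_sum, ← Finset.sum_add_distrib]
  refine Finset.sum_congr rfl fun t _ ↦ Finset.sum_congr rfl fun b₁ _ ↦
    Finset.sum_congr rfl fun b₂ _ ↦ Finset.sum_congr rfl fun b₃ _ ↦ ?_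
  ring

/-- Clearing denominators reduces the sign of a view sum to that of a polynomial `s`. -/
theorem GasRange.viewSum_nonpos {q x : ℝ} (hr : GasRange q x) {h₁₂ h₁₃ h₂₃ a₁ a₂ a₃ : ℕ} {s : ℝ}
    (hs : 0 ≤ s)
    (h : let A := viewSum q x 0 0 h₁₂ h₁₃ h₂₃ a₁ a₂ a₃
      2 * (A * gasZ q x + (viewSum q x 1 0 h₁₂ h₁₃ h₂₃ a₁ a₂ a₃ - A) * gasN q x) *
          dualFactor q x * ((1 + x) * (1 + x * q) * (1 + x * q ^ 2) * (1 + x * q ^ 3)) +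
        (1 - q) ^ 2 * (x ^ 2 * dualNum₁ q x *
            (viewSum q x 0 (Pi.single 1 1) h₁₂ h₁₃ h₂₃ a₁ a₂ a₃ - A) *
            ((1 + x * q ^ 2) * (1 + x * q ^ 3)) +
          x * dualNum₂ q x * (viewSum q x 0 (Pi.single 2 1) h₁₂ h₁₃ h₂₃ a₁ a₂ a₃ - A) *
            ((1 + x * q) * (1 + x * q ^ 3)) +
          dualNum₃ q x * (viewSum q x 0 (Pi.single 3 1) h₁₂ h₁₃ h₂₃ a₁ a₂ a₃ - A) *
            ((1 + x * q) * (1 + x * q ^ 2))) =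
      -(s * ((1 + x) * (1 + x * q) * (1 + x * q ^ 2) * (1 + x * q ^ 3)))) :
    viewSum q x (gasOcc q x) (dual q x) h₁₂ h₁₃ h₂₃ a₁ a₂ a₃ ≤ 0 := by
  have hZ := gasZ_pos hr.q_nonneg hr.x_nonneg
  have hE := hr.dualFactor_pos
  have hq := hr.q_nonneg
  have hx := hr.x_nonneg
  have key : viewSum q x (gasOcc q x) (dual q x) h₁₂ h₁₃ h₂₃ a₁ a₂ a₃ =
      -(s / (2 * gasZ q x * dualFactor q x)) := by
    -- After the affine split the remaining view sums contain neither α nor the multipliers, so they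
    -- expand to plain polynomials in x and q.
    rw [dual, viewSum_single_add]
    simp only [gasOcc, dualDen]
    field_simp
    linear_combination h
  rw [key]
  exact neg_nonpos.2 (by positivity)

/-! ### The 23 local views; a name lists h₁₂h₁₃h₂₃, then a₁a₂a₃. -/

/-- A view of `K33`, where the two other vertices on the side of v are seen by all three neighbours,
so a₁ = a₂ = a₃. The slack vanishes identically. -/
theorem GasRange.viewSum_nonpos_000_000 {q x : ℝ} (h : GasRange q x) :
    viewSum q x (gasOcc q x) (dual q x) 0 0 0 0 0 0 ≤ 0 := by
  refine h.viewSum_nonpos le_rfl ?_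
  simp [viewSum, Pi.single_apply, dualNum₁, dualNum₂, dualNum₃, gasZ, gasN, dualFactor]
  ring

theorem GasRange.viewSum_nonpos_000_001 {q x : ℝ} (h : GasRange q x) :
    viewSum q x (gasOcc q x) (dual q x) 0 0 0 0 0 1 ≤ 0 := by
  have pos : 0 ≤ 3 + 2 * x * (1 - q + 3 * q ^ 2) - x ^ 2 * (q + 2 * q ^ 2 + 2 * q ^ 3 - 5 * q ^ 4)
      - x ^ 3 * (2 * q ^ 4 + 7 * q ^ 5 - 2 * q ^ 6 - q ^ 7) - x ^ 4 * (q ^ 7 + 2 * q ^ 8) := by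
    linarith [h.mono_le 0 0 1 0, h.mono_le 0 0 2 0, h.mono_le 0 0 2 1, h.mono_le 0 0 3 1,
      h.mono_le 0 0 3 2, h.mono_le 0 0 4 3, h.mono_le 0 0 4 4, h.mono_le 0 1 1 0,
      h.mono_le 0 1 1 2, h.mono_nonneg 0 1, h.mono_nonneg 2 1, h.mono_nonneg 4 2,
      h.mono_nonneg 6 3, h.mono_nonneg 7 3]
  have := h.q_nonneg
  have := h.x_nonneg
  have := h.one_sub_nonneg
  -- The slack factors explicitly. A power of 1 - q appears because at q = 1 the spins are
  -- independent and every view is tight.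
  refine h.viewSum_nonpos (mul_nonneg (a := x ^ 3 * (1 - q) ^ 5 / 3) (by positivity) pos) ?_
  simp [viewSum, Pi.single_apply, dualNum₁, dualNum₂, dualNum₃, gasZ, gasN, dualFactor]
  ring

theorem GasRange.viewSum_nonpos_000_002 {q x : ℝ} (h : GasRange q x) :
    viewSum q x (gasOcc q x) (dual q x) 0 0 0 0 0 2 ≤ 0 := by
  have pos : 0 ≤ 3 + 3 * x * (3 + q) + x ^ 2 * (6 + 12 * q - 2 * q ^ 2 - 2 * q ^ 3 + q ^ 4) +
      x ^ 3 * (1 + 5 * q - 2 * q ^ 2 - 3 * q ^ 3 + 4 * q ^ 4 - 4 * q ^ 5 - q ^ 6) - x ^ 4 * (2 *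
      q ^ 2 + 9 * q ^ 4 + 4 * q ^ 5) - x ^ 5 * (4 * q ^ 4 + q ^ 5 + 9 * q ^ 6 + q ^ 7 - 2 * q ^ 8
      - q ^ 9) - 3 * x ^ 6 * (2 * q ^ 7 - q ^ 8) := by
    linarith [h.mono_le 0 0 2 0, h.mono_le 0 0 2 1, h.mono_le 0 0 3 0, h.mono_le 0 0 3 2,
      h.mono_le 0 0 3 3, h.mono_le 0 0 4 0, h.mono_le 0 0 4 1, h.mono_le 0 0 5 0,
      h.mono_le 0 0 5 1, h.mono_le 0 0 5 2, h.mono_le 0 0 6 1, h.mono_le 0 1 1 1,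
      h.mono_le 0 1 2 0, h.mono_le 0 1 4 0, h.mono_le 0 2 2 0, h.mono_nonneg 0 1,
      h.mono_nonneg 0 2, h.mono_nonneg 0 3, h.mono_nonneg 1 1, h.mono_nonneg 1 2,
      h.mono_nonneg 1 3, h.mono_nonneg 4 2, h.mono_nonneg 4 3, h.mono_nonneg 8 5,
      h.mono_nonneg 8 6, h.mono_nonneg 9 5]
  have := h.q_nonneg
  have := h.x_nonneg
  have := h.one_sub_nonneg
  refine h.viewSum_nonpos (mul_nonneg (a := x ^ 2 * (1 - q) ^ 4 * (1 + q) * (2 / 3)) (by positivity) pos) ?_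
  simp [viewSum, Pi.single_apply, dualNum₁, dualNum₂, dualNum₃, gasZ, gasN, dualFactor]
  ring

/-- The residual polynomial is that of `viewSum_nonpos_000_001`; only the prefactor doubles. -/
theorem GasRange.viewSum_nonpos_000_011 {q x : ℝ} (h : GasRange q x) :
    viewSum q x (gasOcc q x) (dual q x) 0 0 0 0 1 1 ≤ 0 := by
  have pos : 0 ≤ 3 + 2 * x * (1 - q + 3 * q ^ 2) - x ^ 2 * (q + 2 * q ^ 2 + 2 * q ^ 3 - 5 * q ^ 4)
      - x ^ 3 * (2 * q ^ 4 + 7 * q ^ 5 - 2 * q ^ 6 - q ^ 7) - x ^ 4 * (q ^ 7 + 2 * q ^ 8) := by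
    linarith [h.mono_le 0 0 1 0, h.mono_le 0 0 2 0, h.mono_le 0 0 2 1, h.mono_le 0 0 3 1,
      h.mono_le 0 0 3 2, h.mono_le 0 0 4 3, h.mono_le 0 0 4 4, h.mono_le 0 1 1 0,
      h.mono_le 0 1 1 2, h.mono_nonneg 0 1, h.mono_nonneg 2 1, h.mono_nonneg 4 2,
      h.mono_nonneg 6 3, h.mono_nonneg 7 3]
  have := h.q_nonneg
  have := h.x_nonneg
  have := h.one_sub_nonneg
  refine h.viewSum_nonpos (mul_nonneg (a := x ^ 3 * (1 - q) ^ 5 * (2 / 3)) (by positivity) pos) ?_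
  simp [viewSum, Pi.single_apply, dualNum₁, dualNum₂, dualNum₃, gasZ, gasN, dualFactor]
  ring

theorem GasRange.viewSum_nonpos_000_012 {q x : ℝ} (h : GasRange q x) :
    viewSum q x (gasOcc q x) (dual q x) 0 0 0 0 1 2 ≤ 0 := by
  have pos : 0 ≤ 3 + 6 * q + 6 * x * (2 + 3 * q + q ^ 2) + x ^ 2 * (6 + 17 * q + 34 * q ^ 2 - 6 *
      q ^ 3 + q ^ 4 + 2 * q ^ 5) + x ^ 3 * (8 * q ^ 2 + 10 * q ^ 3 + 24 * q ^ 4 + 7 * q ^ 5 - 10 *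
      q ^ 6 - 3 * q ^ 7) + 3 * x ^ 4 * (4 * q ^ 5 - q ^ 7) := by
    linarith [h.mono_le 0 0 2 1, h.mono_le 0 0 3 3, h.mono_le 0 0 3 4, h.mono_le 0 0 4 3,
      h.mono_le 0 1 1 2, h.mono_nonneg 0 1, h.mono_nonneg 0 2, h.mono_nonneg 1 0,
      h.mono_nonneg 1 1, h.mono_nonneg 1 2, h.mono_nonneg 2 1, h.mono_nonneg 2 2,
      h.mono_nonneg 2 3, h.mono_nonneg 3 3, h.mono_nonneg 4 2, h.mono_nonneg 4 3,
      h.mono_nonneg 5 2, h.mono_nonneg 5 3, h.mono_nonneg 5 4]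
  have := h.q_nonneg
  have := h.x_nonneg
  have := h.one_sub_nonneg
  have := h.one_sub_sq_mul_cube_nonneg
  -- Here 1 - x²q³ also splits off; it is nonnegative because x²q³ ≤ 1/4.
  refine h.viewSum_nonpos (mul_nonneg (a := x ^ 2 * (1 - q) ^ 4 * (1 - x ^ 2 * q ^ 3) / 3) (by positivity) pos) ?_
  simp [viewSum, Pi.single_apply, dualNum₁, dualNum₂, dualNum₃, gasZ, gasN, dualFactor]
  ring

theorem GasRange.viewSum_nonpos_000_022 {q x : ℝ} (h : GasRange q x) :
    viewSum q x (gasOcc q x) (dual q x) 0 0 0 0 2 2 ≤ 0 := by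
  have pos : 0 ≤ 3 + 3 * x * (3 + q) + x ^ 2 * (4 + 9 * q + 2 * q ^ 2 + q ^ 3 - q ^ 4) - x ^ 3 *
      (q + q ^ 2 - 2 * q ^ 3 - 5 * q ^ 4 + 2 * q ^ 5 + 2 * q ^ 6 + q ^ 7) - x ^ 4 * (2 * q ^ 3 +
      15 * q ^ 4 - q ^ 5 - 5 * q ^ 6 + 3 * q ^ 7 + q ^ 8) - x ^ 5 * (8 * q ^ 6 + 5 * q ^ 7 + 4 *
      q ^ 8 - 4 * q ^ 9 - q ^ 10) - 3 * x ^ 6 * (2 * q ^ 9 - q ^ 10) := by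
    linarith [h.mono_le 0 0 2 2, h.mono_le 0 0 3 2, h.mono_le 0 0 3 3, h.mono_le 0 0 3 4,
      h.mono_le 0 0 4 0, h.mono_le 0 0 4 3, h.mono_le 0 0 4 4, h.mono_le 0 0 5 1,
      h.mono_le 0 0 5 2, h.mono_le 0 0 5 3, h.mono_le 0 0 6 3, h.mono_le 0 1 2 0,
      h.mono_le 0 1 3 0, h.mono_le 0 2 1 0, h.mono_nonneg 0 0, h.mono_nonneg 0 1,
      h.mono_nonneg 0 2, h.mono_nonneg 1 1, h.mono_nonneg 1 2, h.mono_nonneg 2 2,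
      h.mono_nonneg 3 2, h.mono_nonneg 3 3, h.mono_nonneg 4 3, h.mono_nonneg 5 4,
      h.mono_nonneg 6 4, h.mono_nonneg 9 5, h.mono_nonneg 10 5, h.mono_nonneg 10 6]
  have := h.q_nonneg
  have := h.x_nonneg
  have := h.one_sub_nonneg
  refine h.viewSum_nonpos (mul_nonneg (a := x ^ 2 * (1 - q) ^ 4 * (1 + q) * (2 / 3)) (by positivity) pos) ?_
  simp [viewSum, Pi.single_apply, dualNum₁, dualNum₂, dualNum₃, gasZ, gasN, dualFactor]
  ring

theorem GasRange.viewSum_nonpos_000_111 {q x : ℝ} (h : GasRange q x) :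
    viewSum q x (gasOcc q x) (dual q x) 0 0 0 1 1 1 ≤ 0 := by
  refine h.viewSum_nonpos le_rfl ?_
  simp [viewSum, Pi.single_apply, dualNum₁, dualNum₂, dualNum₃, gasZ, gasN, dualFactor]
  ring

/-- The prefactor q is forced: at q = 0 a neighbour with an outer + must be -, so when every aᵢ is 1
or 2 the view averages the tight views 000_111 and 000_222. -/
theorem GasRange.viewSum_nonpos_000_112 {q x : ℝ} (h : GasRange q x) :
    viewSum q x (gasOcc q x) (dual q x) 0 0 0 1 1 2 ≤ 0 := by
  have pos : 0 ≤ 3 + 6 * x * (1 + q) + x ^ 2 * (2 + 15 * q - 5 * q ^ 2 + 2 * q ^ 3 + q ^ 4) +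
      x ^ 3 * (q + 5 * q ^ 2 - 4 * q ^ 3 - q ^ 4 + q ^ 5 - 2 * q ^ 6) - x ^ 4 * (4 * q ^ 3 + 9 *
      q ^ 4 - 8 * q ^ 5 + 11 * q ^ 6 - q ^ 8) - x ^ 5 * (4 * q ^ 5 + 5 * q ^ 6 + 8 * q ^ 7 - 5 *
      q ^ 8) - 3 * x ^ 6 * (2 * q ^ 8 - q ^ 9) := by
    linarith [h.mono_le 0 0 2 0, h.mono_le 0 0 3 0, h.mono_le 0 0 3 1, h.mono_le 0 0 3 3,
      h.mono_le 0 0 4 0, h.mono_le 0 0 4 2, h.mono_le 0 0 5 0, h.mono_le 0 0 5 1,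
      h.mono_le 0 0 5 2, h.mono_le 0 0 6 2, h.mono_le 0 1 1 1, h.mono_le 0 1 3 0,
      h.mono_nonneg 0 1, h.mono_nonneg 0 2, h.mono_nonneg 1 1, h.mono_nonneg 1 2,
      h.mono_nonneg 1 3, h.mono_nonneg 2 3, h.mono_nonneg 3 2, h.mono_nonneg 4 2,
      h.mono_nonneg 5 3, h.mono_nonneg 5 4, h.mono_nonneg 8 4, h.mono_nonneg 8 5,
      h.mono_nonneg 9 6]
  have := h.q_nonneg
  have := h.x_nonneg
  have := h.one_sub_nonneg
  refine h.viewSum_nonpos (mul_nonneg (a := q * x ^ 2 * (1 - q) ^ 4 * (2 / 3)) (by positivity) pos) ?_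
  simp [viewSum, Pi.single_apply, dualNum₁, dualNum₂, dualNum₃, gasZ, gasN, dualFactor]
  ring

theorem GasRange.viewSum_nonpos_000_122 {q x : ℝ} (h : GasRange q x) :
    viewSum q x (gasOcc q x) (dual q x) 0 0 0 1 2 2 ≤ 0 := by
  have pos : 0 ≤ 6 + 3 * x * (4 + 3 * q + q ^ 2) + 2 * x ^ 2 * (2 + 12 * q - 4 * q ^ 2 + 3 * q ^ 3
      + 2 * q ^ 4) + x ^ 3 * (q ^ 2 + 5 * q ^ 3 - 4 * q ^ 4 - q ^ 5 + q ^ 6 - 2 * q ^ 7) - x ^ 4 *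
      (4 * q ^ 3 + 26 * q ^ 4 - 14 * q ^ 5 + 3 * q ^ 6 + 13 * q ^ 7 - q ^ 8 - q ^ 9) - x ^ 5 * (16
      * q ^ 6 + 8 * q ^ 7 + 5 * q ^ 8 - 5 * q ^ 9) - 6 * x ^ 6 * (2 * q ^ 9 - q ^ 10) := by
    linarith [h.mono_le 0 0 2 0, h.mono_le 0 0 3 1, h.mono_le 0 0 3 2, h.mono_le 0 0 3 4,
      h.mono_le 0 0 4 0, h.mono_le 0 0 4 2, h.mono_le 0 0 4 3, h.mono_le 0 0 5 1,
      h.mono_le 0 0 5 2, h.mono_le 0 0 5 3, h.mono_le 0 0 6 3, h.mono_le 0 1 1 1,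
      h.mono_le 0 1 3 0, h.mono_nonneg 0 1, h.mono_nonneg 0 2, h.mono_nonneg 1 1,
      h.mono_nonneg 1 2, h.mono_nonneg 2 1, h.mono_nonneg 2 3, h.mono_nonneg 3 2,
      h.mono_nonneg 3 3, h.mono_nonneg 4 2, h.mono_nonneg 5 4, h.mono_nonneg 6 3,
      h.mono_nonneg 8 4, h.mono_nonneg 9 4, h.mono_nonneg 9 5, h.mono_nonneg 10 6]
  have := h.q_nonneg
  have := h.x_nonneg
  have := h.one_sub_nonneg
  refine h.viewSum_nonpos (mul_nonneg (a := q * x ^ 2 * (1 - q) ^ 4 / 3) (by positivity) pos) ?_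
  simp [viewSum, Pi.single_apply, dualNum₁, dualNum₂, dualNum₃, gasZ, gasN, dualFactor]
  ring

theorem GasRange.viewSum_nonpos_000_222 {q x : ℝ} (h : GasRange q x) :
    viewSum q x (gasOcc q x) (dual q x) 0 0 0 2 2 2 ≤ 0 := by
  refine h.viewSum_nonpos le_rfl ?_
  simp [viewSum, Pi.single_apply, dualNum₁, dualNum₂, dualNum₃, gasZ, gasN, dualFactor]
  ring

/-- Not a view of `K33`: tightness here is the extra equation that pins down the multipliers. -/
theorem GasRange.viewSum_nonpos_100_000 {q x : ℝ} (h : GasRange q x) :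
    viewSum q x (gasOcc q x) (dual q x) 1 0 0 0 0 0 ≤ 0 := by
  refine h.viewSum_nonpos le_rfl ?_
  simp [viewSum, Pi.single_apply, dualNum₁, dualNum₂, dualNum₃, gasZ, gasN, dualFactor]
  ring

theorem GasRange.viewSum_nonpos_100_001 {q x : ℝ} (h : GasRange q x) :
    viewSum q x (gasOcc q x) (dual q x) 1 0 0 0 0 1 ≤ 0 := by
  have pos : 0 ≤ 12 - 3 * q + 2 * x * (4 - 5 * q + 13 * q ^ 2 - 3 * q ^ 3) - x ^ 2 * (4 * q + 7 *
      q ^ 2 + 6 * q ^ 3 - 22 * q ^ 4 + 5 * q ^ 5) - x ^ 3 * (8 * q ^ 4 + 26 * q ^ 5 - 15 * q ^ 6 -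
      2 * q ^ 7 + q ^ 8) - x ^ 4 * (4 * q ^ 7 + 7 * q ^ 8 - 2 * q ^ 9) := by
    linarith [h.mono_le 0 0 0 1, h.mono_le 0 0 1 0, h.mono_le 0 0 2 0, h.mono_le 0 0 3 2,
      h.mono_le 0 0 3 5, h.mono_le 0 0 4 3, h.mono_le 0 0 4 4, h.mono_le 0 1 1 0,
      h.mono_le 0 1 1 4, h.mono_le 0 1 2 3, h.mono_le 2 1 0 1, h.mono_le 2 1 1 0,
      h.mono_le 2 1 1 2, h.mono_le 2 1 2 0, h.mono_nonneg 2 1, h.mono_nonneg 4 2,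
      h.mono_nonneg 6 3, h.mono_nonneg 7 3, h.mono_nonneg 9 4]
  have := h.q_nonneg
  have := h.x_nonneg
  have := h.one_sub_nonneg
  refine h.viewSum_nonpos (mul_nonneg (a := x ^ 3 * (1 - q) ^ 4 / 3) (by positivity) pos) ?_
  simp [viewSum, Pi.single_apply, dualNum₁, dualNum₂, dualNum₃, gasZ, gasN, dualFactor]
  ring

theorem GasRange.viewSum_nonpos_100_002 {q x : ℝ} (h : GasRange q x) :
    viewSum q x (gasOcc q x) (dual q x) 1 0 0 0 0 2 ≤ 0 := by
  have pos : 0 ≤ 3 + 3 * q + 3 * x * (4 + 5 * q + q ^ 2) + x ^ 2 * (6 + 15 * q + 16 * q ^ 2 + 2 *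
      q ^ 3 - q ^ 4 + q ^ 5) - x ^ 3 * (q + 10 * q ^ 3 - 5 * q ^ 4 - 6 * q ^ 5 + 5 * q ^ 6 +
      q ^ 7) - x ^ 4 * (4 * q ^ 3 + 15 * q ^ 4 + 19 * q ^ 5 + 8 * q ^ 6 - 3 * q ^ 7 - q ^ 8) -
      x ^ 5 * (4 * q ^ 5 + 5 * q ^ 6 + 14 * q ^ 7 + 3 * q ^ 8 - q ^ 9 - q ^ 10) - 3 * x ^ 6 * (2 *
      q ^ 8 - q ^ 9) := by
    linarith [h.mono_le 0 0 3 3, h.mono_le 0 0 3 4, h.mono_le 0 0 4 1, h.mono_le 0 0 4 2,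
      h.mono_le 0 0 5 0, h.mono_le 0 0 5 1, h.mono_le 0 0 5 2, h.mono_le 0 0 5 3,
      h.mono_le 0 0 6 2, h.mono_le 0 1 1 3, h.mono_le 0 1 2 1, h.mono_le 0 1 3 0,
      h.mono_le 0 1 3 1, h.mono_le 0 1 3 2, h.mono_le 0 2 1 0, h.mono_nonneg 0 1,
      h.mono_nonneg 0 2, h.mono_nonneg 1 0, h.mono_nonneg 1 1, h.mono_nonneg 1 2,
      h.mono_nonneg 2 1, h.mono_nonneg 2 2, h.mono_nonneg 3 2, h.mono_nonneg 4 3,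
      h.mono_nonneg 5 2, h.mono_nonneg 5 3, h.mono_nonneg 7 4, h.mono_nonneg 8 4,
      h.mono_nonneg 9 5, h.mono_nonneg 9 6, h.mono_nonneg 10 5]
  have := h.q_nonneg
  have := h.x_nonneg
  have := h.one_sub_nonneg
  refine h.viewSum_nonpos (mul_nonneg (a := x ^ 2 * (1 - q) ^ 4 * (2 / 3)) (by positivity) pos) ?_
  simp [viewSum, Pi.single_apply, dualNum₁, dualNum₂, dualNum₃, gasZ, gasN, dualFactor]
  ring

theorem GasRange.viewSum_nonpos_100_010 {q x : ℝ} (h : GasRange q x) :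
    viewSum q x (gasOcc q x) (dual q x) 1 0 0 0 1 0 ≤ 0 := by
  have pos : 0 ≤ 3 + 3 * x * (4 - q + q ^ 2) + x ^ 2 * (10 + 9 * q + 6 * q ^ 2 - 19 * q ^ 3 + 9 *
      q ^ 4) + x ^ 3 * (2 + 10 * q - 3 * q ^ 2 - 7 * q ^ 3 + 10 * q ^ 4 - 18 * q ^ 5 + 5 * q ^ 6 +
      q ^ 7) - x ^ 4 * (4 * q ^ 2 - 2 * q ^ 3 + 5 * q ^ 4 + 12 * q ^ 5 - 9 * q ^ 6 + 7 * q ^ 7 -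
      q ^ 8 - q ^ 9) - x ^ 5 * (8 * q ^ 4 + 2 * q ^ 5 + 10 * q ^ 6 - 2 * q ^ 7 - 8 * q ^ 8 - q ^ 9
      + 3 * q ^ 10) - 3 * x ^ 6 * (4 * q ^ 7 - 2 * q ^ 8 - 2 * q ^ 9 + q ^ 10) := by
    linarith [h.mono_le 0 0 3 2, h.mono_le 0 0 4 1, h.mono_le 0 0 4 3, h.mono_le 0 0 5 0,
      h.mono_le 0 0 5 1, h.mono_le 0 0 5 5, h.mono_le 0 0 6 1, h.mono_le 0 0 6 4,
      h.mono_le 0 1 0 1, h.mono_le 0 1 1 2, h.mono_le 0 1 2 1, h.mono_le 0 1 2 3,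
      h.mono_le 0 1 3 1, h.mono_le 0 1 4 0, h.mono_le 0 2 0 3, h.mono_le 0 3 1 1,
      h.mono_le 1 2 0 2, h.mono_le 1 2 1 0, h.mono_nonneg 1 2, h.mono_nonneg 1 3,
      h.mono_nonneg 2 1, h.mono_nonneg 2 2, h.mono_nonneg 3 4, h.mono_nonneg 4 2,
      h.mono_nonneg 4 3, h.mono_nonneg 6 3, h.mono_nonneg 6 4, h.mono_nonneg 7 3,
      h.mono_nonneg 7 5, h.mono_nonneg 8 4, h.mono_nonneg 8 5, h.mono_nonneg 8 6,
      h.mono_nonneg 9 4, h.mono_nonneg 9 5, h.mono_nonneg 9 6]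
  have := h.q_nonneg
  have := h.x_nonneg
  have := h.one_sub_nonneg
  refine h.viewSum_nonpos (mul_nonneg (a := x ^ 2 * (1 - q) ^ 3 / 3) (by positivity) pos) ?_
  simp [viewSum, Pi.single_apply, dualNum₁, dualNum₂, dualNum₃, gasZ, gasN, dualFactor]
  ring

theorem GasRange.viewSum_nonpos_100_011 {q x : ℝ} (h : GasRange q x) :
    viewSum q x (gasOcc q x) (dual q x) 1 0 0 0 1 1 ≤ 0 := by
  have pos : 0 ≤ 3 + 12 * x + 3 * x ^ 2 * (2 + 3 * q + 4 * q ^ 2 - 4 * q ^ 3 + q ^ 4) + x ^ 3 * (8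
      * q ^ 2 + 2 * q ^ 3 + 14 * q ^ 4 - 11 * q ^ 5 - 2 * q ^ 6 + q ^ 7) + 3 * x ^ 4 * (4 * q ^ 5
      - 4 * q ^ 6 + q ^ 7) := by
    linarith [h.mono_le 0 0 2 1, h.mono_le 0 0 3 2, h.mono_le 0 0 3 3, h.mono_le 0 0 4 2,
      h.mono_le 0 1 1 2, h.mono_nonneg 0 1, h.mono_nonneg 0 2, h.mono_nonneg 1 2,
      h.mono_nonneg 2 2, h.mono_nonneg 2 3, h.mono_nonneg 3 3, h.mono_nonneg 4 2,
      h.mono_nonneg 4 3, h.mono_nonneg 5 4, h.mono_nonneg 7 3, h.mono_nonneg 7 4]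
  have := h.q_nonneg
  have := h.x_nonneg
  have := h.one_sub_nonneg
  have := h.one_sub_sq_mul_cube_nonneg
  refine h.viewSum_nonpos (mul_nonneg (a := x ^ 2 * (1 - q) ^ 3 * (1 - x ^ 2 * q ^ 3) / 3) (by positivity) pos) ?_
  simp [viewSum, Pi.single_apply, dualNum₁, dualNum₂, dualNum₃, gasZ, gasN, dualFactor]
  ring

theorem GasRange.viewSum_nonpos_100_012 {q x : ℝ} (h : GasRange q x) :
    viewSum q x (gasOcc q x) (dual q x) 1 0 0 0 1 2 ≤ 0 := by
  have pos : 0 ≤ 6 + 3 * q - 6 * q ^ 2 + 3 * x * (6 + 4 * q - 3 * q ^ 2 - 3 * q ^ 3) + x ^ 2 * (8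
      + 20 * q + 11 * q ^ 2 - 30 * q ^ 3 + 7 * q ^ 4 + q ^ 5 - 2 * q ^ 6) - x ^ 3 * (2 * q + 2 *
      q ^ 2 - 3 * q ^ 3 - 3 * q ^ 4 - 2 * q ^ 5 + 6 * q ^ 6 + q ^ 7 - 3 * q ^ 8) - x ^ 4 * (4 *
      q ^ 3 + 32 * q ^ 4 + 3 * q ^ 5 - 36 * q ^ 6 + 21 * q ^ 7 - 9 * q ^ 8 - q ^ 9 + q ^ 10) -
      x ^ 5 * (16 * q ^ 6 + 10 * q ^ 7 + 2 * q ^ 8 - 22 * q ^ 9 + 5 * q ^ 10 + q ^ 11) - 3 * x ^ 6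
      * (4 * q ^ 9 - 4 * q ^ 10 + q ^ 11) := by
    linarith [h.mono_le 0 0 0 2, h.mono_le 0 1 0 3, h.mono_le 0 1 1 5, h.mono_le 0 1 2 4,
      h.mono_le 0 1 2 5, h.mono_le 0 1 3 0, h.mono_le 0 1 3 1, h.mono_le 0 1 3 2,
      h.mono_le 0 1 3 4, h.mono_le 0 1 4 2, h.mono_le 0 2 0 3, h.mono_le 0 2 1 0,
      h.mono_le 1 0 2 0, h.mono_le 1 0 4 2, h.mono_le 1 0 4 5, h.mono_le 1 0 5 1,
      h.mono_le 1 0 5 2, h.mono_le 1 0 5 4, h.mono_le 1 0 5 5, h.mono_le 1 0 6 2,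
      h.mono_le 1 0 6 4, h.mono_le 1 1 0 1, h.mono_le 1 1 1 1, h.mono_le 1 2 0 2,
      h.mono_le 1 2 1 0, h.mono_nonneg 1 2, h.mono_nonneg 2 2, h.mono_nonneg 3 3,
      h.mono_nonneg 4 2, h.mono_nonneg 4 3, h.mono_nonneg 5 2, h.mono_nonneg 5 3,
      h.mono_nonneg 6 4, h.mono_nonneg 8 3, h.mono_nonneg 8 4, h.mono_nonneg 9 4,
      h.mono_nonneg 9 5, h.mono_nonneg 10 6]
  have := h.q_nonneg
  have := h.x_nonneg
  have := h.one_sub_nonneg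
  refine h.viewSum_nonpos (mul_nonneg (a := x ^ 2 * (1 - q) ^ 3 / 3) (by positivity) pos) ?_
  simp [viewSum, Pi.single_apply, dualNum₁, dualNum₂, dualNum₃, gasZ, gasN, dualFactor]
  ring

theorem GasRange.viewSum_nonpos_100_110 {q x : ℝ} (h : GasRange q x) :
    viewSum q x (gasOcc q x) (dual q x) 1 0 0 1 1 0 ≤ 0 := by
  have pos : 0 ≤ 3 * q + 3 * x * (1 + q + 2 * q ^ 2) + x ^ 2 * (2 + 2 * q + 27 * q ^ 2 - 20 *
      q ^ 3 + q ^ 4 + 3 * q ^ 5) + x ^ 3 * (q + 11 * q ^ 2 - 2 * q ^ 3 - q ^ 4 - 9 * q ^ 5 - q ^ 6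
      + q ^ 8) - x ^ 4 * (4 * q ^ 3 + 6 * q ^ 5 - 5 * q ^ 6 + 15 * q ^ 7 - 3 * q ^ 8 - 2 * q ^ 9)
      - x ^ 5 * (8 * q ^ 5 + 2 * q ^ 6 + 11 * q ^ 7 - 3 * q ^ 8 - 11 * q ^ 9 + 4 * q ^ 10 +
      q ^ 11) - 3 * x ^ 6 * (4 * q ^ 8 - 2 * q ^ 9 - 2 * q ^ 10 + q ^ 11) := by
    linarith [h.mono_le 0 1 3 4, h.mono_le 0 1 4 1, h.mono_le 0 1 4 3, h.mono_le 0 1 5 3,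
      h.mono_le 0 2 1 2, h.mono_le 0 2 2 1, h.mono_le 0 2 3 2, h.mono_le 1 0 2 0,
      h.mono_le 1 0 3 0, h.mono_le 1 0 3 1, h.mono_le 1 0 3 2, h.mono_le 1 0 4 0,
      h.mono_le 1 0 5 0, h.mono_le 1 0 5 4, h.mono_le 1 0 5 5, h.mono_le 1 0 6 1,
      h.mono_le 1 0 6 4, h.mono_le 1 1 1 1, h.mono_le 1 2 0 2, h.mono_le 1 3 0 2,
      h.mono_le 2 1 1 0, h.mono_nonneg 2 1, h.mono_nonneg 2 2, h.mono_nonneg 2 3,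
      h.mono_nonneg 4 2, h.mono_nonneg 5 2, h.mono_nonneg 6 4, h.mono_nonneg 8 3,
      h.mono_nonneg 8 4, h.mono_nonneg 8 5, h.mono_nonneg 9 4, h.mono_nonneg 9 5,
      h.mono_nonneg 9 6, h.mono_nonneg 10 6]
  have := h.q_nonneg
  have := h.x_nonneg
  have := h.one_sub_nonneg
  refine h.viewSum_nonpos (mul_nonneg (a := x ^ 2 * (1 - q) ^ 3 * (2 / 3)) (by positivity) pos) ?_
  simp [viewSum, Pi.single_apply, dualNum₁, dualNum₂, dualNum₃, gasZ, gasN, dualFactor]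
  ring

theorem GasRange.viewSum_nonpos_100_111 {q x : ℝ} (h : GasRange q x) :
    viewSum q x (gasOcc q x) (dual q x) 1 0 0 1 1 1 ≤ 0 := by
  have pos : 0 ≤ 6 + 3 * x * (4 + 5 * q - q ^ 2) + 2 * x ^ 2 * (2 + 18 * q - 6 * q ^ 2 + q ^ 3) +
      x ^ 3 * (4 * q + 19 * q ^ 2 - 21 * q ^ 3 + 5 * q ^ 5 - 9 * q ^ 6 + 2 * q ^ 7) - x ^ 4 * (12
      * q ^ 3 + 10 * q ^ 4 - 18 * q ^ 5 + 41 * q ^ 6 - 13 * q ^ 7 - 3 * q ^ 8 + q ^ 9) - x ^ 5 *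
      (16 * q ^ 5 + 4 * q ^ 6 + 24 * q ^ 7 - 25 * q ^ 8 + 5 * q ^ 9) - 6 * x ^ 6 * (4 * q ^ 8 - 4
      * q ^ 9 + q ^ 10) := by
    linarith [h.mono_le 0 0 3 3, h.mono_le 0 0 4 0, h.mono_le 0 0 4 2, h.mono_le 0 0 4 5,
      h.mono_le 0 0 5 0, h.mono_le 0 0 5 1, h.mono_le 0 0 5 2, h.mono_le 0 0 5 4,
      h.mono_le 0 0 6 2, h.mono_le 0 0 6 4, h.mono_le 0 1 0 2, h.mono_le 0 1 1 1,
      h.mono_le 0 1 2 1, h.mono_le 0 1 3 0, h.mono_le 0 1 3 1, h.mono_le 0 2 0 2,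
      h.mono_le 1 1 0 1, h.mono_nonneg 1 1, h.mono_nonneg 1 2, h.mono_nonneg 1 3,
      h.mono_nonneg 2 3, h.mono_nonneg 3 2, h.mono_nonneg 5 3, h.mono_nonneg 5 4,
      h.mono_nonneg 7 3, h.mono_nonneg 7 4, h.mono_nonneg 8 4, h.mono_nonneg 8 5,
      h.mono_nonneg 9 6]
  have := h.q_nonneg
  have := h.x_nonneg
  have := h.one_sub_nonneg
  refine h.viewSum_nonpos (mul_nonneg (a := q * x ^ 2 * (1 - q) ^ 3 / 3) (by positivity) pos) ?_
  simp [viewSum, Pi.single_apply, dualNum₁, dualNum₂, dualNum₃, gasZ, gasN, dualFactor]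
  ring

theorem GasRange.viewSum_nonpos_100_112 {q x : ℝ} (h : GasRange q x) :
    viewSum q x (gasOcc q x) (dual q x) 1 0 0 1 1 2 ≤ 0 := by
  have pos : 0 ≤ 6 - 3 * q + 3 * x * (4 + q - q ^ 2) + x ^ 2 * (4 + 22 * q - 23 * q ^ 2 + 17 *
      q ^ 3 - q ^ 4 - q ^ 5) + 3 * x ^ 3 * (4 * q ^ 3 + q ^ 4 - q ^ 5) + 3 * x ^ 4 * (2 * q ^ 6 -
      q ^ 7) := by
    linarith [h.mono_le 0 0 0 1, h.mono_le 0 0 2 0, h.mono_le 0 0 2 2, h.mono_le 0 0 2 3,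
      h.mono_le 0 0 3 2, h.mono_le 0 0 4 3, h.mono_le 0 1 0 2, h.mono_le 0 1 1 1,
      h.mono_nonneg 0 1, h.mono_nonneg 0 2, h.mono_nonneg 1 1, h.mono_nonneg 1 2,
      h.mono_nonneg 3 2, h.mono_nonneg 3 3, h.mono_nonneg 4 3, h.mono_nonneg 6 4]
  have := h.q_nonneg
  have := h.x_nonneg
  have := h.one_sub_nonneg
  have := h.one_sub_sq_mul_cube_nonneg
  refine h.viewSum_nonpos (mul_nonneg (a := q * x ^ 2 * (1 - q) ^ 3 * (1 - x ^ 2 * q ^ 3) * (2 / 3)) (by positivity) pos) ?_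
  simp [viewSum, Pi.single_apply, dualNum₁, dualNum₂, dualNum₃, gasZ, gasN, dualFactor]
  ring

theorem GasRange.viewSum_nonpos_110_000 {q x : ℝ} (h : GasRange q x) :
    viewSum q x (gasOcc q x) (dual q x) 1 1 0 0 0 0 ≤ 0 := by
  have pos : 0 ≤ 6 - 3 * q + 3 * x * (2 - q + 4 * q ^ 2 - 2 * q ^ 3) + x ^ 2 * (1 + 4 * q - 3 *
      q ^ 2 - q ^ 3 + 11 * q ^ 4 - 6 * q ^ 5) - x ^ 3 * (2 * q ^ 2 - 2 * q ^ 3 + 15 * q ^ 5 - 10 *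
      q ^ 6 + q ^ 8) - x ^ 4 * (4 * q ^ 4 + q ^ 5 + 5 * q ^ 6 - q ^ 7 + 2 * q ^ 8 - 2 * q ^ 9) - 3
      * x ^ 5 * (2 * q ^ 7 - q ^ 8) := by
    linarith [h.mono_le 0 0 0 1, h.mono_le 0 0 2 3, h.mono_le 0 0 3 2, h.mono_le 0 0 3 5,
      h.mono_le 0 0 4 1, h.mono_le 0 0 4 2, h.mono_le 0 0 4 4, h.mono_le 0 0 5 2,
      h.mono_le 0 1 0 1, h.mono_le 0 1 0 3, h.mono_le 0 1 1 4, h.mono_le 0 1 3 1,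
      h.mono_le 0 2 1 1, h.mono_le 1 2 0 1, h.mono_le 1 2 0 2, h.mono_le 2 1 0 1,
      h.mono_nonneg 2 1, h.mono_nonneg 3 3, h.mono_nonneg 4 2, h.mono_nonneg 6 3,
      h.mono_nonneg 7 4, h.mono_nonneg 8 5, h.mono_nonneg 9 4]
  have := h.q_nonneg
  have := h.x_nonneg
  have := h.one_sub_nonneg
  refine h.viewSum_nonpos (mul_nonneg (a := x ^ 3 * (1 - q) ^ 3 * (2 / 3)) (by positivity) pos) ?_
  simp [viewSum, Pi.single_apply, dualNum₁, dualNum₂, dualNum₃, gasZ, gasN, dualFactor]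
  ring

theorem GasRange.viewSum_nonpos_110_001 {q x : ℝ} (h : GasRange q x) :
    viewSum q x (gasOcc q x) (dual q x) 1 1 0 0 0 1 ≤ 0 := by
  have pos : 0 ≤ 3 + 18 * x + x ^ 2 * (10 + 9 * q + 30 * q ^ 2 - 16 * q ^ 3 + 3 * q ^ 4) + x ^ 3 *
      (16 * q ^ 2 + 4 * q ^ 3 + 26 * q ^ 4 - 13 * q ^ 5 - 4 * q ^ 6 + q ^ 7) + 3 * x ^ 4 * (8 *
      q ^ 5 - 6 * q ^ 6 + q ^ 7) := by
    linarith [h.mono_le 0 0 3 2, h.mono_le 0 0 3 3, h.mono_le 0 0 4 2, h.mono_le 0 1 1 2,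
      h.mono_le 0 1 2 3, h.mono_nonneg 0 1, h.mono_nonneg 0 2, h.mono_nonneg 1 2,
      h.mono_nonneg 2 2, h.mono_nonneg 2 3, h.mono_nonneg 3 3, h.mono_nonneg 4 2,
      h.mono_nonneg 4 3, h.mono_nonneg 5 4, h.mono_nonneg 7 3, h.mono_nonneg 7 4]
  have := h.q_nonneg
  have := h.x_nonneg
  have := h.one_sub_nonneg
  have := h.one_sub_sq_mul_cube_nonneg
  refine h.viewSum_nonpos (mul_nonneg (a := x ^ 2 * (1 - q) ^ 3 * (1 - x ^ 2 * q ^ 3) / 3) (by positivity) pos) ?_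
  simp [viewSum, Pi.single_apply, dualNum₁, dualNum₂, dualNum₃, gasZ, gasN, dualFactor]
  ring

theorem GasRange.viewSum_nonpos_110_011 {q x : ℝ} (h : GasRange q x) :
    viewSum q x (gasOcc q x) (dual q x) 1 1 0 0 1 1 ≤ 0 := by
  have pos : 0 ≤ 3 + 3 * x * (3 + q + q ^ 2) + x ^ 2 * (4 + 9 * q + 6 * q ^ 2 + 2 * q ^ 3 + 3 *
      q ^ 4) - x ^ 3 * (q - 7 * q ^ 3 - 3 * q ^ 4 + 3 * q ^ 5 - 2 * q ^ 6 + 2 * q ^ 7) - x ^ 4 *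
      (2 * q ^ 3 + 17 * q ^ 4 - 3 * q ^ 5 - 7 * q ^ 6 + 13 * q ^ 7 - q ^ 9) - 3 * x ^ 5 * (4 *
      q ^ 6 + 2 * q ^ 7 + 3 * q ^ 8 - 2 * q ^ 9) - 6 * x ^ 6 * (2 * q ^ 9 - q ^ 10) := by
    linarith [h.mono_le 0 0 3 2, h.mono_le 0 0 3 4, h.mono_le 0 0 4 0, h.mono_le 0 0 4 3,
      h.mono_le 0 0 5 1, h.mono_le 0 0 5 2, h.mono_le 0 0 5 3, h.mono_le 0 0 6 3,
      h.mono_le 0 1 3 0, h.mono_le 0 1 3 1, h.mono_le 0 2 1 0, h.mono_nonneg 0 1,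
      h.mono_nonneg 0 2, h.mono_nonneg 1 1, h.mono_nonneg 1 2, h.mono_nonneg 2 1,
      h.mono_nonneg 2 2, h.mono_nonneg 3 2, h.mono_nonneg 3 3, h.mono_nonneg 4 2,
      h.mono_nonneg 4 3, h.mono_nonneg 5 4, h.mono_nonneg 6 3, h.mono_nonneg 6 4,
      h.mono_nonneg 9 4, h.mono_nonneg 9 5, h.mono_nonneg 10 6]
  have := h.q_nonneg
  have := h.x_nonneg
  have := h.one_sub_nonneg
  refine h.viewSum_nonpos (mul_nonneg (a := x ^ 2 * (1 - q) ^ 3 * (2 / 3)) (by positivity) pos) ?_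
  simp [viewSum, Pi.single_apply, dualNum₁, dualNum₂, dualNum₃, gasZ, gasN, dualFactor]
  ring

/-- The view of a K₄ component, which has no outer neighbours. -/
theorem GasRange.viewSum_nonpos_111_000 {q x : ℝ} (h : GasRange q x) :
    viewSum q x (gasOcc q x) (dual q x) 1 1 1 0 0 0 ≤ 0 := by
  have pos : 0 ≤ 3 + x * (2 + 9 * q ^ 2 - 2 * q ^ 3) + x ^ 2 * (4 * q ^ 2 + q ^ 3 + 6 * q ^ 4 -
      q ^ 5 - q ^ 6) + 3 * x ^ 3 * (2 * q ^ 5 - q ^ 6) := by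
    linarith [h.mono_le 0 0 1 2, h.mono_le 0 0 2 3, h.mono_le 0 0 2 4, h.mono_le 0 0 3 3,
      h.mono_nonneg 0 0, h.mono_nonneg 0 1, h.mono_nonneg 2 1, h.mono_nonneg 2 2,
      h.mono_nonneg 3 2, h.mono_nonneg 4 2, h.mono_nonneg 5 3]
  have := h.q_nonneg
  have := h.x_nonneg
  have := h.one_sub_nonneg
  have := h.one_sub_sq_mul_cube_nonneg
  refine h.viewSum_nonpos (mul_nonneg (a := x ^ 3 * (1 - q) ^ 3 * (1 - x ^ 2 * q ^ 3) * 2) (by positivity) pos) ?_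
  simp [viewSum, Pi.single_apply, dualNum₁, dualNum₂, dualNum₃, gasZ, gasN, dualFactor]
  ring

/-! ### Reduction to the listed views by symmetry. -/

/-- Reordering the sums over two spins relabels the neighbours; together with `viewSum_swap₂₃` this
gives all of S₃. -/
theorem viewSum_swap₁₂ (q x α : ℝ) (c : ℕ → ℝ) (h₁₂ h₁₃ h₂₃ a₁ a₂ a₃ : ℕ) :
    viewSum q x α c h₁₂ h₂₃ h₁₃ a₂ a₁ a₃ = viewSum q x α c h₁₂ h₁₃ h₂₃ a₁ a₂ a₃ := by
  unfold viewSum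
  refine Finset.sum_congr rfl fun t _ ↦ ?_
  rw [Finset.sum_comm]
  refine Finset.sum_congr rfl fun b₁ _ ↦ Finset.sum_congr rfl fun b₂ _ ↦
    Finset.sum_congr rfl fun b₃ _ ↦ ?_
  ring_nf

theorem viewSum_swap₂₃ (q x α : ℝ) (c : ℕ → ℝ) (h₁₂ h₁₃ h₂₃ a₁ a₂ a₃ : ℕ) :
    viewSum q x α c h₁₃ h₁₂ h₂₃ a₁ a₃ a₂ = viewSum q x α c h₁₂ h₁₃ h₂₃ a₁ a₂ a₃ := by
  unfold viewSum
  refine Finset.sum_congr rfl fun t _ ↦ Finset.sum_congr rfl fun b₁ _ ↦ ?_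
  rw [Finset.sum_comm]
  refine Finset.sum_congr rfl fun b₂ _ ↦ Finset.sum_congr rfl fun b₃ _ ↦ ?_
  ring_nf

namespace GasRange

variable {q x : ℝ}

theorem viewSum_nonpos_no_edge (h : GasRange q x) {a₁ a₂ a₃ : ℕ} (h₁ : a₁ ≤ 2) (h₂ : a₂ ≤ 2)
    (h₃ : a₃ ≤ 2) : viewSum q x (gasOcc q x) (dual q x) 0 0 0 a₁ a₂ a₃ ≤ 0 := by
  have sorted {a₁ a₂ a₃ : ℕ} (h₁₂ : a₁ ≤ a₂) (h₂₃ : a₂ ≤ a₃) (h₃ : a₃ ≤ 2) :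
      viewSum q x (gasOcc q x) (dual q x) 0 0 0 a₁ a₂ a₃ ≤ 0 := by
    interval_cases a₃ <;> interval_cases a₂ <;> interval_cases a₁
    exacts [h.viewSum_nonpos_000_000, h.viewSum_nonpos_000_001, h.viewSum_nonpos_000_011,
      h.viewSum_nonpos_000_111, h.viewSum_nonpos_000_002, h.viewSum_nonpos_000_012,
      h.viewSum_nonpos_000_112, h.viewSum_nonpos_000_022, h.viewSum_nonpos_000_122,
      h.viewSum_nonpos_000_222]
  -- Sorting in two stages: a smallest count is moved to the front, then the other two are ordered.
  have first_le {a₁ a₂ a₃ : ℕ} (h₁₂ : a₁ ≤ a₂) (h₁₃ : a₁ ≤ a₃) (h₂ : a₂ ≤ 2) (h₃ : a₃ ≤ 2) :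
      viewSum q x (gasOcc q x) (dual q x) 0 0 0 a₁ a₂ a₃ ≤ 0 := by
    rcases le_total a₂ a₃ with h' | h'
    · exact sorted h₁₂ h' h₃
    · rw [← viewSum_swap₂₃]
      exact sorted h₁₃ h' h₂
  by_cases h₁ₘ : a₁ ≤ a₂ ∧ a₁ ≤ a₃
  · exact first_le h₁ₘ.1 h₁ₘ.2 h₂ h₃
  rcases le_total a₂ a₃ with h' | h'
  · rw [← viewSum_swap₁₂]
    exact first_le (by omega) h' h₁ h₃
  · rw [← viewSum_swap₂₃, ← viewSum_swap₁₂]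
    exact first_le (by omega) h' h₁ h₂

theorem viewSum_nonpos_one_edge (h : GasRange q x) {a₁ a₂ a₃ : ℕ} (h₁ : a₁ ≤ 1) (h₂ : a₂ ≤ 1)
    (h₃ : a₃ ≤ 2) : viewSum q x (gasOcc q x) (dual q x) 1 0 0 a₁ a₂ a₃ ≤ 0 := by
  wlog h' : a₁ ≤ a₂ generalizing a₁ a₂
  · rw [← viewSum_swap₁₂]
    exact this h₂ h₁ (by omega)
  interval_cases a₂ <;> interval_cases a₁ <;> interval_cases a₃
  exacts [h.viewSum_nonpos_100_000, h.viewSum_nonpos_100_001, h.viewSum_nonpos_100_002,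
    h.viewSum_nonpos_100_010, h.viewSum_nonpos_100_011, h.viewSum_nonpos_100_012,
    h.viewSum_nonpos_100_110, h.viewSum_nonpos_100_111, h.viewSum_nonpos_100_112]

theorem viewSum_nonpos_two_edges (h : GasRange q x) {a₂ a₃ : ℕ} (h₂ : a₂ ≤ 1)
    (h₃ : a₃ ≤ 1) : viewSum q x (gasOcc q x) (dual q x) 1 1 0 0 a₂ a₃ ≤ 0 := by
  wlog h' : a₂ ≤ a₃ generalizing a₂ a₃
  · rw [← viewSum_swap₂₃]
    exact this h₃ h₂ (by omega)
  interval_cases a₃ <;> interval_cases a₂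
  exacts [h.viewSum_nonpos_110_000, h.viewSum_nonpos_110_001, h.viewSum_nonpos_110_011]

/-- The dual solution is feasible: every local view of a cubic graph has nonpositive sum. -/
theorem viewSum_nonpos_of_degree_le (h : GasRange q x) {h₁₂ h₁₃ h₂₃ a₁ a₂ a₃ : ℕ}
    (e₁₂ : h₁₂ ≤ 1) (e₁₃ : h₁₃ ≤ 1) (e₂₃ : h₂₃ ≤ 1) (d₁ : a₁ + h₁₂ + h₁₃ ≤ 2)
    (d₂ : a₂ + h₁₂ + h₂₃ ≤ 2) (d₃ : a₃ + h₁₃ + h₂₃ ≤ 2) :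
    viewSum q x (gasOcc q x) (dual q x) h₁₂ h₁₃ h₂₃ a₁ a₂ a₃ ≤ 0 := by
  -- Up to relabelling, only the number of edges among the neighbours matters. With two edges, their
  -- common endpoint has no outer neighbour left.
  interval_cases h₁₂ <;> interval_cases h₁₃ <;> interval_cases h₂₃
  · exact h.viewSum_nonpos_no_edge (by omega) (by omega) (by omega)
  · rw [← viewSum_swap₁₂, ← viewSum_swap₂₃]
    exact h.viewSum_nonpos_one_edge (by omega) (by omega) (by omega)
  · rw [← viewSum_swap₂₃]
    exact h.viewSum_nonpos_one_edge (by omega) (by omega) (by omega)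
  · obtain rfl : a₃ = 0 := by omega
    rw [← viewSum_swap₂₃, ← viewSum_swap₁₂]
    exact h.viewSum_nonpos_two_edges (by omega) (by omega)
  · exact h.viewSum_nonpos_one_edge (by omega) (by omega) (by omega)
  · obtain rfl : a₂ = 0 := by omega
    rw [← viewSum_swap₁₂]
    exact h.viewSum_nonpos_two_edges (by omega) (by omega)
  · obtain rfl : a₁ = 0 := by omega
    exact h.viewSum_nonpos_two_edges (by omega) (by omega)
  · obtain ⟨rfl, rfl, rfl⟩ : a₁ = 0 ∧ a₂ = 0 ∧ a₃ = 0 := by omega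
    exact h.viewSum_nonpos_111_000

end GasRange

open Finset Function

/-! ### Changing single spins. -/

section Spins

variable {V : Type*} [DecidableEq V]

/-- Requiring spin - beforehand makes every change an increment, which avoids truncated subtraction
in ℕ. -/
theorem toNat_update (σ : V → Bool) (a v : V) (b : Bool) (ha : σ a = false) :
    (update σ a b v).toNat = (σ v).toNat + if v = a then b.toNat else 0 := by
  by_cases h : v = a
  · subst h; simp [ha]
  · simp [h]

/-- The spins of `σ` with those at four vertices replaced. -/
def update₄ (σ : V → Bool) (v u₁ u₂ u₃ : V) (t b₁ b₂ b₃ : Bool) : V → Bool :=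
  update (update (update (update σ v t) u₁ b₁) u₂ b₂) u₃ b₃

theorem update₄_update₄ (σ : V → Bool) (v u₁ u₂ u₃ : V) (t b₁ b₂ b₃ t' b₁' b₂' b₃' : Bool) :
    update₄ (update₄ σ v u₁ u₂ u₃ t' b₁' b₂' b₃') v u₁ u₂ u₃ t b₁ b₂ b₃ =
      update₄ σ v u₁ u₂ u₃ t b₁ b₂ b₃ := by
  funext w
  simp only [update₄, update_apply]
  split_ifs <;> rfl

/-- Trades the classical instance in the definition for the one from the ambient `DecidableEq V`. -/
theorem partitionFunction_eq_sum [Fintype V] (G : SimpleGraph V) (B l : ℝ) :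
    partitionFunction G B l = ∑ σ : V → Bool, B ^ monoEdges G σ * l ^ plusCount σ := by
  unfold partitionFunction
  congr!

end Spins

/-! ### From the Ising weight to the lattice gas. -/

section Gas

variable {V : Type*} [Fintype V] (G : SimpleGraph V) [DecidableRel G.Adj]

/-- The number of neighbours of `v` with spin `+`. -/
def plusNbrs (σ : V → Bool) (v : V) : ℕ := ∑ u ∈ G.neighborFinset v, (σ u).toNat

/-- Twice the number of edges joining two vertices with spin `+`. -/
def plusPairs (σ : V → Bool) : ℕ := ∑ v, (σ v).toNat * plusNbrs G σ v

/-- The number of vertices with spin `+`, as a sum. -/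
def plusSum (σ : V → Bool) : ℕ := ∑ v, (σ v).toNat

/-- The Ising weight up to a global factor, with `B` the edge activity and `x = λ / B ^ 3`. -/
noncomputable def gasWeight (B x : ℝ) (σ : V → Bool) : ℝ :=
  x ^ plusSum σ * B ^ plusPairs G σ

/-- The slack of the dual solution `(α, c)` at the vertex `v` of the configuration `σ`. -/
noncomputable def vertexSlack (α : ℝ) (c : ℕ → ℝ) (σ : V → Bool) (v : V) : ℝ :=
  (σ v).toNat - α + c (plusNbrs G σ v) - (∑ u ∈ G.neighborFinset v, c (plusNbrs G σ u)) / 3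

/-- In a cubic graph the multipliers cancel in the sum over all vertices. -/
theorem sum_vertexSlack (hG : ∀ v, #(G.neighborFinset v) = 3) (α : ℝ) (c : ℕ → ℝ)
    (σ : V → Bool) :
    ∑ v, vertexSlack G α c σ v = plusSum σ - α * Fintype.card V := by
  have h : ∑ v, ∑ u ∈ G.neighborFinset v, c (plusNbrs G σ u) =
      ∑ u, 3 * c (plusNbrs G σ u) := by
    rw [Finset.sum_comm' (t' := univ) (s' := fun u ↦ G.neighborFinset u)]
    · simp [hG]
    · simp [G.adj_comm]
  simp only [vertexSlack, sum_sub_distrib, sum_add_distrib, ← sum_div, h, ← mul_sum, plusSum]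
  simp
  ring

theorem plusNbrs_le (hG : ∀ v, #(G.neighborFinset v) = 3) (σ : V → Bool) (v : V) :
    plusNbrs G σ v ≤ 3 := by
  rw [← hG v, Finset.card_eq_sum_ones]
  exact sum_le_sum fun u _ ↦ Bool.toNat_le _

theorem plusCount_eq_plusSum (σ : V → Bool) : plusCount σ = plusSum σ := by
  have h : {v : V | σ v = true} = ((univ.filter fun v ↦ σ v = true : Finset V) : Set V) := by
    ext; simp
  rw [plusCount, h, Set.ncard_coe_finset, card_filter, plusSum]
  exact sum_congr rfl fun v _ ↦ by cases σ v <;> rfl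

/-- The handshake lemma for the subgraph of monochromatic edges. -/
theorem two_mul_monoEdges (σ : V → Bool) :
    2 * monoEdges G σ = ∑ v, ∑ u ∈ G.neighborFinset v, if σ v = σ u then 1 else 0 := by
  let H : SimpleGraph V :=
    { Adj := fun u v ↦ G.Adj u v ∧ σ u = σ v
      symm := ⟨fun u v h ↦ ⟨h.1.symm, h.2.symm⟩⟩
      loopless := ⟨fun v h ↦ G.irrefl h.1⟩ }
  have : DecidableRel H.Adj := fun u v ↦ inferInstanceAs (Decidable (G.Adj u v ∧ σ u = σ v))
  have h₁ : {e : Sym2 V | e ∈ G.edgeSet ∧ (e.map σ).IsDiag} = (H.edgeFinset : Set (Sym2 V)) := by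
    ext e
    induction e with
    | _ u v => simp [H]
  rw [monoEdges, h₁, Set.ncard_coe_finset, ← H.sum_degrees_eq_twice_card_edges]
  refine sum_congr rfl fun v _ ↦ ?_
  rw [← card_filter, ← SimpleGraph.card_neighborFinset_eq_degree]
  congr 1
  ext u
  simp [H]

/-- Each edge `uv` satisfies `[σ u = σ v] + [σ u = +] + [σ v = +] = 1 + 2 [σ u = σ v = +]`. -/
theorem monoEdges_add (hG : ∀ v, #(G.neighborFinset v) = 3) (σ : V → Bool) :
    monoEdges G σ + 3 * plusSum σ = #G.edgeFinset + plusPairs G σ := by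
  have hE : ∑ v, #(G.neighborFinset v) = 2 * #G.edgeFinset := by
    rw [← G.sum_degrees_eq_twice_card_edges]; rfl
  have h₁ (v u : V) : (if σ v = σ u then 1 else 0) + (σ v).toNat + (σ u).toNat =
      1 + 2 * ((σ v).toNat * (σ u).toNat) := by
    cases σ v <;> cases σ u <;> rfl
  -- Summed over ordered adjacent pairs, every edge counts twice, and by regularity each
  -- one-endpoint term yields `3 * plusSum σ`.
  have h₂ := sum_congr rfl fun v (_ : v ∈ univ) ↦
    sum_congr rfl fun u (_ : u ∈ G.neighborFinset v) ↦ h₁ v u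
  have h₃ : ∑ v, ∑ u ∈ G.neighborFinset v, (σ u).toNat = 3 * plusSum σ := by
    rw [Finset.sum_comm' (t' := univ) (s' := fun u ↦ G.neighborFinset u)]
    · simp [hG, plusSum, mul_sum]
    · simp [G.adj_comm]
  simp only [sum_add_distrib, ← two_mul_monoEdges, h₃, ← mul_sum] at h₂
  simp only [sum_const, hG, smul_eq_mul, mul_one, ← mul_sum] at h₂ hE
  change 2 * monoEdges G σ + 3 * plusSum σ + 3 * plusSum σ = _ + 2 * plusPairs G σ at h₂
  omega

/-- Substituting λ = xB³ raises the exponent of B to the left side of `monoEdges_add`. -/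
theorem weight_eq_gasWeight (hG : ∀ v, #(G.neighborFinset v) = 3) {B lam : ℝ} (hB : B ≠ 0)
    (σ : V → Bool) :
    B ^ monoEdges G σ * lam ^ plusCount σ =
      B ^ #G.edgeFinset * gasWeight G B (lam / B ^ 3) σ := by
  have h : lam = lam / B ^ 3 * B ^ 3 := by field_simp
  rw [gasWeight, plusCount_eq_plusSum]
  calc B ^ monoEdges G σ * lam ^ plusSum σ
      = (lam / B ^ 3) ^ plusSum σ * B ^ (monoEdges G σ + 3 * plusSum σ) := by
        conv_lhs => rw [h]
        rw [mul_pow, pow_add, pow_mul]; ring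
    _ = _ := by rw [monoEdges_add G hG, pow_add]; ring

/-! ### Resampling a vertex and its neighbours. -/

variable [DecidableEq V]

theorem plusNbrs_update (σ : V → Bool) (a v : V) (b : Bool) (ha : σ a = false) :
    plusNbrs G (update σ a b) v = plusNbrs G σ v + (if G.Adj v a then 1 else 0) * b.toNat := by
  simp only [plusNbrs, toNat_update σ a _ b ha, sum_add_distrib, Finset.sum_ite_eq',
    SimpleGraph.mem_neighborFinset, ite_mul, one_mul, zero_mul]

theorem plusSum_update (σ : V → Bool) (a : V) (b : Bool) (ha : σ a = false) :
    plusSum (update σ a b) = plusSum σ + b.toNat := by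
  simp [plusSum, toNat_update σ a _ b ha, sum_add_distrib]

/-- The factor 2 has two sources: the new term at a, and the count at each + neighbour of a growing
by one. -/
theorem plusPairs_update (σ : V → Bool) (a : V) (b : Bool) (ha : σ a = false) :
    plusPairs G (update σ a b) = plusPairs G σ + 2 * (b.toNat * plusNbrs G σ a) := by
  have h₁ (v : V) : (update σ a b v).toNat * plusNbrs G (update σ a b) v =
      (σ v).toNat * plusNbrs G σ v + (if v = a then b.toNat * plusNbrs G σ v else 0) +
        b.toNat * (if G.Adj a v then (σ v).toNat else 0) := by
    rw [toNat_update σ a v b ha, plusNbrs_update G σ a v b ha]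
    by_cases h : v = a
    · subst h; simp [ha]
    · simp only [h, if_false, G.adj_comm v a]
      split_ifs <;> ring
  have h₂ : ∑ v, (if G.Adj a v then (σ v).toNat else 0) = plusNbrs G σ a := by
    rw [plusNbrs, ← sum_filter, SimpleGraph.neighborFinset_eq_filter]
  simp only [plusPairs, h₁, sum_add_distrib, ← mul_sum, h₂]
  simp
  ring

theorem gasWeight_update (B x : ℝ) (σ : V → Bool) (a : V) (b : Bool) (ha : σ a = false) :
    gasWeight G B x (update σ a b) =
      gasWeight G B x σ * (x ^ b.toNat * (B ^ 2) ^ (b.toNat * plusNbrs G σ a)) := by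
  rw [gasWeight, gasWeight, plusSum_update σ a b ha, plusPairs_update G σ a b ha, pow_add, pow_add,
    pow_mul B 2]
  ring

/-- Resampling the spin at one vertex. -/
theorem sum_sum_update (F : (V → Bool) → ℝ) (a : V) :
    ∑ σ : V → Bool, ∑ b : Bool, F (update σ a b) = 2 * ∑ σ, F σ := by
  have h (σ : V → Bool) : ∑ b : Bool, F (update σ a b) = F σ + F (update σ a (!σ a)) := by
    rw [Fintype.sum_bool]
    cases h : σ a
    · rw [show update σ a false = σ by rw [← h, update_eq_self], Bool.not_false, add_comm]
    · rw [show update σ a true = σ by rw [← h, update_eq_self], Bool.not_true]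
  -- Flipping the spin at a permutes the configurations, so each is hit twice.
  have hinv : Involutive fun σ : V → Bool ↦ update σ a (!σ a) := fun σ ↦ by simp
  have hsum : ∑ σ, F (update σ a (!σ a)) = ∑ σ, F σ := Equiv.sum_comp hinv.toPerm F
  simp only [h, sum_add_distrib, hsum]
  ring

theorem sum_sum_update₄ (F : (V → Bool) → ℝ) (v u₁ u₂ u₃ : V) :
    ∑ σ : V → Bool, ∑ t : Bool, ∑ b₁ : Bool, ∑ b₂ : Bool, ∑ b₃ : Bool,
      F (update₄ σ v u₁ u₂ u₃ t b₁ b₂ b₃) = 16 * ∑ σ, F σ := by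
  unfold update₄
  rw [sum_sum_update (fun σ ↦ ∑ b₁ : Bool, ∑ b₂ : Bool, ∑ b₃ : Bool,
      F (update (update (update σ u₁ b₁) u₂ b₂) u₃ b₃)),
    sum_sum_update (fun σ ↦ ∑ b₂ : Bool, ∑ b₃ : Bool, F (update (update σ u₂ b₂) u₃ b₃)),
    sum_sum_update (fun σ ↦ ∑ b₃ : Bool, F (update σ u₃ b₃)), sum_sum_update]
  ring

/-- The sum over the spins of a vertex and its neighbours of the weighted slack is a view sum. -/
theorem sum_gasWeight_mul_vertexSlack (B x α : ℝ) (c : ℕ → ℝ) (σ : V → Bool) {v u₁ u₂ u₃ : V}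
    (h₁₂ : u₁ ≠ u₂) (h₁₃ : u₁ ≠ u₃) (h₂₃ : u₂ ≠ u₃) (hN : G.neighborFinset v = {u₁, u₂, u₃})
    (σv : σ v = false) (σ₁ : σ u₁ = false) (σ₂ : σ u₂ = false) (σ₃ : σ u₃ = false) :
    ∑ t : Bool, ∑ b₁ : Bool, ∑ b₂ : Bool, ∑ b₃ : Bool,
      gasWeight G B x (update₄ σ v u₁ u₂ u₃ t b₁ b₂ b₃) *
        vertexSlack G α c (update₄ σ v u₁ u₂ u₃ t b₁ b₂ b₃) v =
      gasWeight G B x σ * viewSum (B ^ 2) x α c (if G.Adj u₁ u₂ then 1 else 0)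
        (if G.Adj u₁ u₃ then 1 else 0) (if G.Adj u₂ u₃ then 1 else 0)
        (plusNbrs G σ u₁) (plusNbrs G σ u₂) (plusNbrs G σ u₃) := by
  have adj (u : V) : G.Adj v u ↔ u = u₁ ∨ u = u₂ ∨ u = u₃ := by
    rw [← SimpleGraph.mem_neighborFinset, hN]; simp
  have a₁ : G.Adj v u₁ := (adj _).2 (by simp)
  have a₂ : G.Adj v u₂ := (adj _).2 (by simp)
  have a₃ : G.Adj v u₃ := (adj _).2 (by simp)
  have hv : plusNbrs G σ v = 0 := by simp [plusNbrs, hN, σ₁, σ₂, σ₃]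
  simp only [viewSum, mul_sum]
  refine sum_congr rfl fun t _ ↦ sum_congr rfl fun b₁ _ ↦ sum_congr rfl fun b₂ _ ↦
    sum_congr rfl fun b₃ _ ↦ ?_
  have τ₁ : update σ v t u₁ = false := by rw [update_of_ne a₁.ne', σ₁]
  have τ₂ : update (update σ v t) u₁ b₁ u₂ = false := by
    rw [update_of_ne h₁₂.symm, update_of_ne a₂.ne', σ₂]
  have τ₃ : update (update (update σ v t) u₁ b₁) u₂ b₂ u₃ = false := by
    rw [update_of_ne h₂₃.symm, update_of_ne h₁₃.symm, update_of_ne a₃.ne', σ₃]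
  have hnb (w : V) : plusNbrs G (update₄ σ v u₁ u₂ u₃ t b₁ b₂ b₃) w =
      plusNbrs G σ w + (if G.Adj w v then 1 else 0) * t.toNat +
        (if G.Adj w u₁ then 1 else 0) * b₁.toNat + (if G.Adj w u₂ then 1 else 0) * b₂.toNat +
        (if G.Adj w u₃ then 1 else 0) * b₃.toNat := by
    rw [update₄, plusNbrs_update G _ _ _ _ τ₃, plusNbrs_update G _ _ _ _ τ₂,
      plusNbrs_update G _ _ _ _ τ₁, plusNbrs_update G _ _ _ _ σv]
  have hvt : update₄ σ v u₁ u₂ u₃ t b₁ b₂ b₃ v = t := by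
    simp [update₄, update_of_ne, a₁.ne, a₂.ne, a₃.ne]
  have hsum (f : V → ℝ) : ∑ u ∈ G.neighborFinset v, f u = f u₁ + f u₂ + f u₃ := by
    rw [hN, sum_insert (by simp [h₁₂, h₁₃]), sum_insert (by simp [h₂₃]), sum_singleton]
    ring
  -- Spins are switched on in the order v, u₁, u₂, u₃; each + vertex contributes x and one q per +
  -- neighbour already present, which gives the exponents in `viewSum`.
  rw [vertexSlack, hsum, hvt, hnb, hnb, hnb, hnb, update₄, gasWeight_update G _ _ _ _ _ τ₃,
    gasWeight_update G _ _ _ _ _ τ₂, gasWeight_update G _ _ _ _ _ τ₁,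
    gasWeight_update G _ _ _ _ _ σv]
  simp only [plusNbrs_update G _ _ _ _ τ₂, plusNbrs_update G _ _ _ _ τ₁,
    plusNbrs_update G _ _ _ _ σv, hv, a₁, a₂, a₃, a₁.symm, a₂.symm, a₃.symm, SimpleGraph.irrefl,
    G.adj_comm u₂ u₁, G.adj_comm u₃ u₁, G.adj_comm u₃ u₂, if_true, if_false, one_mul, zero_mul,
    zero_add, add_zero, mul_zero, pow_zero, mul_one]
  ring

theorem sum_gasWeight_mul_vertexSlack_nonpos {B x : ℝ} (hB : 0 ≤ B) (hr : GasRange (B ^ 2) x)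
    (hG : ∀ v, #(G.neighborFinset v) = 3) (v : V) :
    ∑ σ, gasWeight G B x σ * vertexSlack G (gasOcc (B ^ 2) x) (dual (B ^ 2) x) σ v ≤ 0 := by
  obtain ⟨u₁, u₂, u₃, h₁₂, h₁₃, h₂₃, hN⟩ := card_eq_three.1 (hG v)
  have adj (u : V) : G.Adj v u ↔ u = u₁ ∨ u = u₂ ∨ u = u₃ := by
    rw [← SimpleGraph.mem_neighborFinset, hN]; simp
  have a₁ : G.Adj v u₁ := (adj _).2 (by simp)
  have a₂ : G.Adj v u₂ := (adj _).2 (by simp)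
  have a₃ : G.Adj v u₃ := (adj _).2 (by simp)
  have key : ∑ σ : V → Bool, ∑ t : Bool, ∑ b₁ : Bool, ∑ b₂ : Bool, ∑ b₃ : Bool,
      gasWeight G B x (update₄ σ v u₁ u₂ u₃ t b₁ b₂ b₃) *
        vertexSlack G (gasOcc (B ^ 2) x) (dual (B ^ 2) x)
          (update₄ σ v u₁ u₂ u₃ t b₁ b₂ b₃) v ≤ 0 := by
    refine sum_nonpos fun σ _ ↦ ?_
    -- Clearing the four inner spins isolates the outer configuration, so `plusNbrs G τ uᵢ` counts
    -- outer + vertices only.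
    set τ := update₄ σ v u₁ u₂ u₃ false false false false with hτ
    have τv : τ v = false := by simp [hτ, update₄, update_of_ne, a₁.ne, a₂.ne, a₃.ne]
    have τ₁ : τ u₁ = false := by simp [hτ, update₄, update_of_ne, h₁₂, h₁₃]
    have τ₂ : τ u₂ = false := by simp [hτ, update₄, update_of_ne, h₂₃]
    have τ₃ : τ u₃ = false := by simp [hτ, update₄]
    have hστ (t b₁ b₂ b₃ : Bool) :
        update₄ σ v u₁ u₂ u₃ t b₁ b₂ b₃ = update₄ τ v u₁ u₂ u₃ t b₁ b₂ b₃ :=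
      (update₄_update₄ ..).symm
    simp only [hστ]
    rw [sum_gasWeight_mul_vertexSlack G B x _ _ τ h₁₂ h₁₃ h₂₃ hN τv τ₁ τ₂ τ₃]
    have hx := hr.x_nonneg
    refine mul_nonpos_of_nonneg_of_nonpos (by unfold gasWeight; positivity) ?_
    -- Degree bounds for the view: with all four inner spins +, the bound 3 at uᵢ, less 1 for v,
    -- leaves 2.
    have hnb (w : V) := plusNbrs_le G hG (update₄ τ v u₁ u₂ u₃ true true true true) w
    have σ₁ : update τ v true u₁ = false := by rw [update_of_ne a₁.ne', τ₁]
    have σ₂ : update (update τ v true) u₁ true u₂ = false := by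
      rw [update_of_ne h₁₂.symm, update_of_ne a₂.ne', τ₂]
    have σ₃ : update (update (update τ v true) u₁ true) u₂ true u₃ = false := by
      rw [update_of_ne h₂₃.symm, update_of_ne h₁₃.symm, update_of_ne a₃.ne', τ₃]
    simp only [update₄, plusNbrs_update G _ _ _ _ σ₃, plusNbrs_update G _ _ _ _ σ₂,
      plusNbrs_update G _ _ _ _ σ₁, plusNbrs_update G _ _ _ _ τv, Bool.toNat_true, mul_one]
      at hnb
    have n₁ := hnb u₁
    have n₂ := hnb u₂
    have n₃ := hnb u₃
    simp only [a₁.symm, a₂.symm, a₃.symm, SimpleGraph.irrefl, G.adj_comm u₂ u₁, G.adj_comm u₃ u₁,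
      G.adj_comm u₃ u₂, if_true, if_false, add_zero] at n₁ n₂ n₃
    exact hr.viewSum_nonpos_of_degree_le (by split_ifs <;> simp) (by split_ifs <;> simp)
      (by split_ifs <;> simp) (by omega) (by omega) (by omega)
  rw [sum_sum_update₄ fun σ ↦
    gasWeight G B x σ * vertexSlack G (gasOcc (B ^ 2) x) (dual (B ^ 2) x) σ v] at key
  linarith

/-- Weak duality: after summing over vertices, the multipliers cancel and only density minus α
survives. -/
theorem sum_gasWeight_mul_plusSum_le {B x : ℝ} (hB : 0 ≤ B) (hr : GasRange (B ^ 2) x)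
    (hG : ∀ v, #(G.neighborFinset v) = 3) :
    ∑ σ, gasWeight G B x σ * plusSum σ ≤
      gasOcc (B ^ 2) x * (Fintype.card V * ∑ σ, gasWeight G B x σ) := by
  have h := sum_nonpos fun v (_ : v ∈ univ) ↦ sum_gasWeight_mul_vertexSlack_nonpos G hB hr hG v
  rw [sum_comm] at h
  simp only [← mul_sum, sum_vertexSlack G hG, mul_sub, sum_sub_distrib] at h
  rw [← sum_mul] at h
  linarith

/-! ### The occupancy fraction as a mean density. -/

theorem occupancyFraction_eq (hG : ∀ v, #(G.neighborFinset v) = 3) {B lam : ℝ} (hB : 0 < B)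
    (hlam : 0 < lam) :
    occupancyFraction G B lam = (∑ σ, gasWeight G B (lam / B ^ 3) σ * plusSum σ) /
      (Fintype.card V * ∑ σ, gasWeight G B (lam / B ^ 3) σ) := by
  have hpos : 0 < ∑ σ : V → Bool, B ^ monoEdges G σ * lam ^ plusCount σ :=
    sum_pos (fun σ _ ↦ by positivity) univ_nonempty
  have hd : HasDerivAt (fun l : ℝ ↦ ∑ σ : V → Bool, B ^ monoEdges G σ * l ^ plusCount σ)
      (∑ σ : V → Bool, B ^ monoEdges G σ * (plusCount σ * lam ^ (plusCount σ - 1))) lam :=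
    HasDerivAt.fun_sum fun σ _ ↦ (hasDerivAt_pow _ _).const_mul _
  have hN : lam * ∑ σ : V → Bool, B ^ monoEdges G σ * (plusCount σ * lam ^ (plusCount σ - 1)) =
      B ^ #G.edgeFinset * ∑ σ, gasWeight G B (lam / B ^ 3) σ * plusSum σ := by
    rw [mul_sum, mul_sum]
    refine sum_congr rfl fun σ _ ↦ ?_
    rw [← mul_assoc (B ^ #G.edgeFinset), ← weight_eq_gasWeight G hG hB.ne',
      ← plusCount_eq_plusSum]
    -- The truncated exponent at count 0 is harmless: its coefficient is 0.
    rcases Nat.eq_zero_or_pos (plusCount σ) with h0 | h0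
    · simp [h0]
    · conv_rhs => rw [← Nat.sub_add_cancel h0, pow_succ]
      push_cast [Nat.sub_add_cancel h0]
      ring
  have hZ : ∑ σ : V → Bool, B ^ monoEdges G σ * lam ^ plusCount σ =
      B ^ #G.edgeFinset * ∑ σ, gasWeight G B (lam / B ^ 3) σ := by
    rw [mul_sum]
    exact sum_congr rfl fun σ _ ↦ weight_eq_gasWeight G hG hB.ne' σ
  have hB' : B ^ #G.edgeFinset ≠ 0 := pow_ne_zero _ hB.ne'
  simp only [occupancyFraction, partitionFunction_eq_sum]
  rw [(hd.log hpos.ne').deriv, div_mul_div_comm, hN, hZ, mul_left_comm,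
    mul_div_mul_left _ _ hB']

theorem sum_gasWeight_pos {B x : ℝ} (hB : 0 < B) (hx : 0 < x) :
    0 < ∑ σ, gasWeight G B x σ :=
  sum_pos (fun σ _ ↦ by unfold gasWeight; positivity) univ_nonempty

end Gas

/-! ### Explicit evaluation for `K33`. -/

/-- Sum over the spins of three vertices of a function of the number of `+` spins. -/
theorem sum_fin_three_bool (g : ℕ → ℝ) :
    ∑ f : Fin 3 → Bool, g (∑ i, (f i).toNat) = g 0 + 3 * g 1 + 3 * g 2 + g 3 := by
  let e : Bool × Bool × Bool ≃ (Fin 3 → Bool) :=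
    { toFun := fun p ↦ ![p.1, p.2.1, p.2.2]
      invFun := fun f ↦ (f 0, f 1, f 2)
      left_inv := fun _ ↦ rfl
      right_inv := fun f ↦ by funext i; fin_cases i <;> rfl }
  have h : ∑ f : Fin 3 → Bool, g (∑ i, (f i).toNat) =
      ∑ p : Bool × Bool × Bool, g (p.1.toNat + p.2.1.toNat + p.2.2.toNat) :=
    (Fintype.sum_equiv e _ _ fun p ↦ by rw [Fin.sum_univ_three]; rfl).symm
  simp [h, Fintype.sum_prod_type]
  ring

theorem K33_neighborFinset_card [DecidableRel K33.Adj] (v : Fin 3 ⊕ Fin 3) :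
    #(K33.neighborFinset v) = 3 := by
  rcases v with v | v
  · rw [show K33.neighborFinset (Sum.inl v) = univ.map ⟨Sum.inr, Sum.inr_injective⟩ by
      ext (u | u) <;> simp [K33]]
    simp
  · rw [show K33.neighborFinset (Sum.inr v) = univ.map ⟨Sum.inl, Sum.inl_injective⟩ by
      ext (u | u) <;> simp [K33]]
    simp

theorem K33_plusPairs [DecidableRel K33.Adj] (σ : Fin 3 ⊕ Fin 3 → Bool) :
    plusPairs K33 σ =
      2 * ((∑ i, (σ (Sum.inl i)).toNat) * ∑ i, (σ (Sum.inr i)).toNat) := by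
  have h (v : Fin 3 ⊕ Fin 3) :
      plusNbrs K33 σ v = ∑ u, if K33.Adj v u then (σ u).toNat else 0 := by
    rw [plusNbrs, ← sum_filter, SimpleGraph.neighborFinset_eq_filter]
  simp only [plusPairs, h, Fintype.sum_sum_type]
  simp [K33, ← sum_mul]
  ring

/-- With i and j spins + on the two sides the weight is x^(i+j) q^(ij). Taking F = 1 gives `gasZ`,
and F n = n gives six times `gasN`. -/
theorem K33_sum_gasWeight [DecidableRel K33.Adj] (B x : ℝ) (F : ℕ → ℝ) :
    ∑ σ, gasWeight K33 B x σ * F (plusSum σ) =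
      F 0 + 6 * x * F 1 + 3 * x ^ 2 * (2 + 3 * B ^ 2) * F 2 +
        2 * x ^ 3 * (1 + 9 * (B ^ 2) ^ 2) * F 3 +
        3 * x ^ 4 * (2 * (B ^ 2) ^ 3 + 3 * (B ^ 2) ^ 4) * F 4 + 6 * x ^ 5 * (B ^ 2) ^ 6 * F 5 +
        x ^ 6 * (B ^ 2) ^ 9 * F 6 := by
  have h (σ : Fin 3 ⊕ Fin 3 → Bool) : gasWeight K33 B x σ * F (plusSum σ) =
      (fun i j ↦ x ^ (i + j) * (B ^ 2) ^ (i * j) * F (i + j))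
        (∑ i, (σ (Sum.inl i)).toNat) (∑ i, (σ (Sum.inr i)).toNat) := by
    rw [gasWeight, K33_plusPairs, plusSum, Fintype.sum_sum_type, pow_mul]
  simp only [h]
  set w : ℕ → ℕ → ℝ := fun i j ↦ x ^ (i + j) * (B ^ 2) ^ (i * j) * F (i + j) with hw
  have hprod : ∑ σ : Fin 3 ⊕ Fin 3 → Bool,
      w (∑ i, (σ (Sum.inl i)).toNat) (∑ i, (σ (Sum.inr i)).toNat) =
      ∑ f : Fin 3 → Bool, ∑ g : Fin 3 → Bool, w (∑ i, (f i).toNat) (∑ i, (g i).toNat) := by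
    rw [← Fintype.sum_prod_type']
    exact Fintype.sum_equiv (Equiv.sumArrowEquivProdArrow (Fin 3) (Fin 3) Bool) _ _ fun σ ↦ rfl
  rw [hprod]
  simp only [sum_fin_three_bool (w _)]
  rw [sum_fin_three_bool fun i ↦ w i 0 + 3 * w i 1 + 3 * w i 2 + w i 3, hw]
  ring_nf

theorem K33_occupancyFraction {B lam : ℝ} (hB : 0 < B) (hlam : 0 < lam) :
    occupancyFraction K33 B lam = gasOcc (B ^ 2) (lam / B ^ 3) := by
  classical
  rw [occupancyFraction_eq K33 K33_neighborFinset_card hB hlam]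
  have h₁ := K33_sum_gasWeight B (lam / B ^ 3) fun _ ↦ 1
  have h₂ := K33_sum_gasWeight B (lam / B ^ 3) fun n ↦ n
  simp only [mul_one] at h₁
  rw [h₁, h₂, gasOcc,
    ← mul_div_mul_left (gasN _ _) _ (by norm_num : (6 : ℝ) ≠ 0)]
  have hcard : (Fintype.card (Fin 3 ⊕ Fin 3) : ℝ) = 6 := by simp
  rw [hcard, gasN, gasZ]
  congr 1
  push_cast
  ring

/-- All three caps on λ are at most B/2, and xq = λ/B. -/
theorem gasRange_of_mem {B lam : ℝ} (hR : (B, lam) ∈ regionMax1 ∪ regionMax2 ∪ regionMax3)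
    (hB : 0 < B) : GasRange (B ^ 2) (lam / B ^ 3) := by
  have h : B ≤ 1 ∧ 0 ≤ lam ∧ lam ≤ B / 2 := by
    rcases hR with (⟨_, _, _, _⟩ | ⟨_, _, _, _⟩) | ⟨_, _, _, _⟩ <;>
      refine ⟨?_, ?_, ?_⟩ <;> simp only at * <;> linarith
  obtain ⟨h₁, h₂, h₃⟩ := h
  refine ⟨by positivity, pow_le_one₀ hB.le h₁, by positivity, ?_⟩
  rw [show lam / B ^ 3 * B ^ 2 = lam / B by field_simp, div_le_iff₀ hB]
  linarith

end Ising

theorem theorem1p4 (B lam : ℝ)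
    (hR : (B, lam) ∈ Ising.regionMax1 ∪ Ising.regionMax2 ∪ Ising.regionMax3) :
    Ising.IsCubic Ising.K33 ∧
      ∀ (V : Type*) [Fintype V] [Nonempty V] (G : SimpleGraph V),
        Ising.IsCubic G →
          Ising.occupancyFraction G B lam ≤ Ising.occupancyFraction Ising.K33 B lam := by
  classical
  refine ⟨fun v ↦ ?_, fun V _ _ G hG ↦ ?_⟩
  · rw [← SimpleGraph.card_neighborFinset_eq_degree]
    convert Ising.K33_neighborFinset_card v
  have hG' (v : V) : (G.neighborFinset v).card = 3 := by
    rw [SimpleGraph.card_neighborFinset_eq_degree]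
    convert hG v
  have hlam : 0 ≤ lam := by
    rcases hR with (⟨_, _, h, _⟩ | ⟨_, _, h, _⟩) | ⟨_, _, h, _⟩ <;> exact h
  -- At λ = 0 the prefactor makes both sides 0; otherwise the cap on λ forces B > 0, so x is
  -- defined.
  rcases hlam.eq_or_lt with rfl | hlam
  · simp [Ising.occupancyFraction]
  have hB : 0 < B := by
    rcases hR with (⟨_, _, _, h⟩ | ⟨_, _, _, h⟩) | ⟨_, _, _, h⟩ <;> simp only at h <;> linarith
  have hZ : 0 < ∑ σ, Ising.gasWeight G B (lam / B ^ 3) σ :=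
    Ising.sum_gasWeight_pos G hB (by positivity)
  rw [Ising.K33_occupancyFraction hB hlam, Ising.occupancyFraction_eq G hG' hB hlam,
    div_le_iff₀ (by positivity)]
  exact Ising.sum_gasWeight_mul_plusSum_le G hB.le (Ising.gasRange_of_mem hR hB) hG'
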